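/- **Setting.** Let $\Gamma$ be a Hausdorff topological commutative group with a continuous morphism $\nu:\Gamma\to(0,\infty)$, $\inf\nu(\Gamma)=0$; write $\varepsilon\to0$ for $\nu(\varepsilon)\to0$ and $\Gamma_1=\nu^{-1}(0,1]$, and topologize $\bar\Gamma=\Gamma\cup\{0\}$ so that $\Gamma$ is open and the sets $\{0\}\cup\nu^{-1}(0,a)$, $a>0$, form a base of neighbourhoods of $0$. Let $(X,d)$ be a complete, locally compact metric space; $B(x,r)$ and $\bar B(x,r)$ are the open and closed balls. A *dilatation structure* $(X,d,\delta)$ consists of partially defined maps $\delta^x_\varepsilon$ ($x\in X$, $\varepsilon\in\Gamma$) with domain $U(x)$ if $\nu(\varepsilon)\le1$ and $W_\varepsilon(x)$ if $\nu(\varepsilon)>1$, such that: * **A0.** For $\nu(\varepsilon)\le 1$, $\delta^x_\varepsilon:U(x)\to V_\varepsilon(x)$ is a homeomorphism between open neighbourhoods of $x$, and $V_\varepsilon(x)\subset U(x)$. There is $A>1$ with $\bar B(x,A)\subset U(x)$ for all $x$ and $B(x,\nu(\varepsilon))\subset\delta^x_\varepsilon B(x,A)$ for $\nu(\varepsilon)<1$.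 There is $B>1$ such that for $\nu(\varepsilon)>1$ the map $\delta^x_\varepsilon:W_\varepsilon(x)\to B(x,B)$ is injective, where $W_\varepsilon(x)$ is an open neighbourhood of $x$ containing $V_{\varepsilon^{-1}}(x)$. For $\varepsilon\in\Gamma_1$, $u\in U(x)$: $\delta^x_{\varepsilon^{-1}}\delta^x_\varepsilon u=u$. For each compact $K\subset X$ there are $R\in(0,A]$ and $\varepsilon_0\in(0,1)$ with $\delta^x_\varepsilon v\in W_{\varepsilon^{-1}}(\delta^x_\varepsilon u)$ whenever $x\in K$, $u,v\in\bar B(x,R)$, $\nu(\varepsilon)<\varepsilon_0$. * **A1.** $\delta^x_\varepsilon x=x$; $\delta^x_1=\mathrm{id}$ on $U(x)$; $(\varepsilon,x,y)\mapsto\delta^x_\varepsilon y$ is continuous on its domain in $\Gamma\times X\times X$ and extends continuously to the closure of this domain in $\bar\Gamma\times X\times X$; $\lim_{\varepsilon\to0}\delta^x_\varepsilon y=x$ for $y\in U(x)$. * **A2.** $\delta^x_\varepsilon\delta^x_\mu u=\delta^x_{\varepsilon\mu}u$ for $\varepsilon,\mu\in\Gamma_1$, $u\in\bar B(x,A)$.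 * **A3.** $d^x(u,v)=\lim_{\varepsilon\to0}\nu(\varepsilon)^{-1}d(\delta^x_\varepsilon u,\delta^x_\varepsilon v)$ exists uniformly in $u,v\in\bar B(x,A)$ and $x$ in compact sets, and $d^x(u,v)=0$ implies $u=v$. Put $\Delta^x_\varepsilon(u,v)=\delta_{\varepsilon^{-1}}^{\delta^x_\varepsilon u}\delta^x_\varepsilon v$, $\Sigma^x_\varepsilon(u,v)=\delta^x_{\varepsilon^{-1}}\delta_\varepsilon^{\delta^x_\varepsilon u}v$, $\mathrm{inv}^x_\varepsilon(u)=\delta_{\varepsilon^{-1}}^{\delta^x_\varepsilon u}x$, and let $\Delta^x,\Sigma^x,\mathrm{inv}^x$ be their limits as $\varepsilon\to0$. The structure is *strong* (A4) if for each compact $K$ there is $R>0$ such that $\Delta^x_\varepsilon(u,v)\to\Delta^x(u,v)$ uniformly in $x\in K$, $u,v\in\bar B(x,R)$. It is *linear* if for each nonempty compact $K$ there is $C>0$ such that $$\delta^x_\varepsilon\delta^y_\mu z=\delta_\mu^{\delta^x_\varepsilon y}\delta^x_\varepsilon z$$ for all $\varepsilon,\mu\in\Gamma_1$ and all $x,y,z\in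 K$ with mutual distances at most $C$. A *normed local conical group* is a local group (a neighbourhood of a neutral element $e$ with locally defined, locally uniformly continuous operation and inverse satisfying the group axioms near $e$) with a continuous local action of $\Gamma$ by maps $\delta_\varepsilon$ that, for $\varepsilon\in\Gamma_1$, are morphisms near $e$, satisfies $\delta_\varepsilon u\to e$ as $\varepsilon\to0$, and has a continuous norm ($\|u\|\ge0$, with $\|u\|=0$ only for $u=e$; $\|uv\|\le\|u\|+\|v\|$; $\|u^{-1}\|=\|u\|$) with $\|\delta_\varepsilon u\|=\nu(\varepsilon)\|u\|$ for $\varepsilon\in\Gamma_1$, all near $e$. Its dilatation structure has the dilatations $(\mu,u,v)\mapsto u\,\delta_\mu(u^{-1}v)$ and the distance $\|u^{-1}v\|$. **Theorem.** Let $(X,d,\delta)$ be a dilatation structure. (a) If it is linear, then the transformations $\Delta^x_\varepsilon(u,\cdot)$ are linear. That is, for each nonempty compact $K\subset X$ there is $C>0$ such that for all $x\in K$, $u\in B(x,C)$, $\varepsilon\in\Gamma_1$ the map $\Delta^x_\varepsilon(u,\cdot)$ is Lipschitz on $B(x,C)$ and $$\Delta^x_\varepsilon(u,\delta^y_\mu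 v)=\delta_\mu^{\Delta^x_\varepsilon(u,y)}\Delta^x_\varepsilon(u,v)\qquad(y,v\in B(x,C),\ \mu\in\Gamma_1),$$ all these expressions being well defined. (b) Suppose that it is strong. Then for each $x\in X$ the tangent space $T_xX$, with neutral element $x$, operation $\Sigma^x$, inverse $\mathrm{inv}^x$, dilatations $\delta^x_\varepsilon$ and norm $d^x(x,\cdot)$, is well defined and a normed local conical group near $x$, in which $u^{-1}v$ is $\Delta^x(u,v)$. Moreover $(X,d,\delta)$ is linear if and only if each $x\in X$ has an open neighbourhood $D$, contained together with the products involved in a neighbourhood of $x$ where $T_xX$ is such a group, on whose closure $(d^x,\delta)$ coincides with the dilatation structure of $T_xX$: for all $u,v\in\overline D$ and $\mu\in\Gamma_1$, $d^x(u,v)$ is the distance of $u,v$ in $T_xX$, and $\delta^u_\mu v$ is the dilatation of $T_xX$, that is $$\delta^u_\mu v=\Sigma^x\bigl(u,\delta^x_\mu\Delta^x(u,v)\bigr).$$ -/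

import Mathlib

open Filter Topology Set Metric
open scoped NNReal

namespace Dilatation

/-- A continuous morphism `ν` from the topological commutative group `Γ` to the multiplicative
group `(0, ∞)`, with `inf ν(Γ) = 0`. -/
structure Scale (Γ : Type*) [CommGroup Γ] [TopologicalSpace Γ] where
  ν : Γ →* ℝ
  pos : ∀ ε, 0 < ν ε
  cont : Continuous ν
  inf_eq_zero : IsGLB (range ν) 0

namespace Scale

variable {Γ : Type*} [CommGroup Γ] [TopologicalSpace Γ]

/-- The end `ε → 0` of `Γ`: the filter generated by the sets `ν⁻¹(0, a)`, `a > 0`. -/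
def toZero (s : Scale Γ) : Filter Γ := comap s.ν (𝓝[>] 0)

/-- The space `Γ ∪ {0}`. -/
def Bar (_s : Scale Γ) : Type _ := WithZero Γ

/-- The inclusion of `Γ` in `Γ ∪ {0}`. -/
def toBar (s : Scale Γ) (ε : Γ) : s.Bar := (ε : WithZero Γ)

/-- The added point `0` of `Γ ∪ {0}`. -/
def zeroBar (s : Scale Γ) : s.Bar := (0 : WithZero Γ)

/-- The topology of `Γ ∪ {0}`: `Γ` is an open subspace and the sets `{0} ∪ ν⁻¹(0, a)`, `a > 0`,
are a base of neighbourhoods of `0`. -/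
instance (s : Scale Γ) : TopologicalSpace s.Bar where
  IsOpen t := IsOpen (s.toBar ⁻¹' t) ∧
    (s.zeroBar ∈ t → ∃ a : ℝ, 0 < a ∧ ∀ ε, s.ν ε < a → s.toBar ε ∈ t)
  isOpen_univ := ⟨isOpen_univ, fun _ => ⟨1, one_pos, fun _ _ => mem_univ _⟩⟩
  isOpen_inter := by
    rintro t t' ⟨h1, h2⟩ ⟨h1', h2'⟩
    refine ⟨h1.inter h1', fun h => ?_⟩
    obtain ⟨a, ha, h3⟩ := h2 h.1
    obtain ⟨b, hb, h4⟩ := h2' h.2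
    exact ⟨min a b, lt_min ha hb, fun ε hε =>
      ⟨h3 ε (hε.trans_le (min_le_left _ _)), h4 ε (hε.trans_le (min_le_right _ _))⟩⟩
  isOpen_sUnion := by
    intro T hT
    refine ⟨?_, ?_⟩
    · rw [preimage_sUnion]
      exact isOpen_biUnion fun t ht => (hT t ht).1
    · rintro ⟨t, ht, h0⟩
      obtain ⟨a, ha, h⟩ := (hT t ht).2 h0
      exact ⟨a, ha, fun ε hε => ⟨t, ht, h ε hε⟩⟩

/-- `d^x(u, v) = lim_{ε → 0} d(δ^x_ε u, δ^x_ε v) / ν(ε)`. -/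
noncomputable def tangentDist {X : Type*} [MetricSpace X] (s : Scale Γ) (δ : Γ → X → X → X)
    (x u v : X) : ℝ :=
  limUnder s.toZero fun ε => dist (δ ε x u) (δ ε x v) / s.ν ε

end Scale

/-- A dilatation structure `(X, d, δ)` (axioms A0, A1, A2, A3, with nondegenerate `d^x`).
The dilatation `δ^x_ε` is `δ ε x`; it is a partial function, whose values matter only on `U x`
if `ν ε ≤ 1` and on `W ε x` if `ν ε > 1`. -/
structure DilatationStructure {Γ : Type*} [CommGroup Γ] [TopologicalSpace Γ] (s : Scale Γ)
    (X : Type*) [MetricSpace X] where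
  δ : Γ → X → X → X
  U : X → Set X
  V : Γ → X → Set X
  W : Γ → X → Set X
  A : ℝ
  B : ℝ
  -- Axiom A0.
  one_lt_A : 1 < A
  one_lt_B : 1 < B
  isOpen_U : ∀ x, IsOpen (U x)
  mem_V : ∀ ε x, s.ν ε ≤ 1 → x ∈ V ε x
  isOpen_V : ∀ ε x, s.ν ε ≤ 1 → IsOpen (V ε x)
  closedBall_subset_U : ∀ x, closedBall x A ⊆ U x
  /-- `δ^x_ε : U(x) → V_ε(x)` is a homeomorphism. -/
  homeo : ∀ ε x, s.ν ε ≤ 1 → ∃ e : OpenPartialHomeomorph X X,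
    e.source = U x ∧ e.target = V ε x ∧ EqOn e (δ ε x) (U x)
  ball_subset_image : ∀ ε x, s.ν ε < 1 → ball x (s.ν ε) ⊆ δ ε x '' ball x A
  V_subset_U : ∀ ε x, s.ν ε ≤ 1 → V ε x ⊆ U x
  mem_W : ∀ ε x, 1 < s.ν ε → x ∈ W ε x
  isOpen_W : ∀ ε x, 1 < s.ν ε → IsOpen (W ε x)
  mapsTo_W : ∀ ε x, 1 < s.ν ε → MapsTo (δ ε x) (W ε x) (ball x B)
  injOn_W : ∀ ε x, 1 < s.ν ε → InjOn (δ ε x) (W ε x)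
  V_subset_W : ∀ ε x, 1 < s.ν ε → V ε⁻¹ x ⊆ W ε x
  inv_apply : ∀ ε x, s.ν ε ≤ 1 → ∀ u ∈ U x, δ ε⁻¹ x (δ ε x u) = u
  /-- The condition on co-domains that gives a sense to `Δ^x_ε(u, v)`. -/
  codomain : ∀ K : Set X, IsCompact K → ∃ R : ℝ, 0 < R ∧ R ≤ A ∧ ∃ ε₀ : ℝ, 0 < ε₀ ∧ ε₀ < 1 ∧
    ∀ x ∈ K, ∀ u ∈ closedBall x R, ∀ v ∈ closedBall x R, ∀ ε, s.ν ε < ε₀ →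
      δ ε x v ∈ W ε⁻¹ (δ ε x u)
  -- Axiom A1.
  apply_self : ∀ ε x, δ ε x x = x
  one_apply : ∀ x, ∀ u ∈ U x, δ 1 x u = u
  continuousOn : ContinuousOn (fun p : Γ × X × X => δ p.1 p.2.1 p.2.2)
    {p | (s.ν p.1 ≤ 1 → p.2.2 ∈ U p.2.1) ∧ (1 < s.ν p.1 → p.2.2 ∈ W p.1 p.2.1)}
  /-- `δ` extends continuously to the closure of its domain in `(Γ ∪ {0}) × X × X`. -/
  extension : ∃ F : s.Bar × X × X → X,
    ContinuousOn F (closure {q | ∃ ε x y, q = (s.toBar ε, x, y) ∧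
      (s.ν ε ≤ 1 → y ∈ U x) ∧ (1 < s.ν ε → y ∈ W ε x)}) ∧
    ∀ ε x y, (s.ν ε ≤ 1 → y ∈ U x) → (1 < s.ν ε → y ∈ W ε x) →
      F (s.toBar ε, x, y) = δ ε x y
  tendsto_zero : ∀ x, ∀ y ∈ U x, Tendsto (fun ε => δ ε x y) s.toZero (𝓝 x)
  -- Axiom A2.
  mul_apply : ∀ ε μ x, s.ν ε ≤ 1 → s.ν μ ≤ 1 → ∀ u ∈ closedBall x A,
    δ ε x (δ μ x u) = δ (ε * μ) x u
  -- Axiom A3, and nondegeneracy of `d^x`.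
  tangentDist_unif : ∀ K : Set X, IsCompact K →
    TendstoUniformlyOn (fun ε (p : X × X × X) => dist (δ ε p.1 p.2.1) (δ ε p.1 p.2.2) / s.ν ε)
      (fun p => s.tangentDist δ p.1 p.2.1 p.2.2) s.toZero
      {p | p.1 ∈ K ∧ p.2.1 ∈ closedBall p.1 A ∧ p.2.2 ∈ closedBall p.1 A}
  nondegenerate : ∀ x, ∀ u ∈ closedBall x A, ∀ v ∈ closedBall x A,
    s.tangentDist δ x u v = 0 → u = v

/-- `O` is an open neighbourhood of `e` in `X` on which the operation `mul`, with neutral element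
`e` and inverse `inv`, the maps `dil ε` and the function `nrm` satisfy the axioms of a normed local
conical group: the uniform local group axioms, `dil` is a local action of `Γ` by morphisms which
contracts `O` to `e`, and `nrm` is a homogeneous norm. -/
structure IsNormedLocalConicalGroup {Γ : Type*} [CommGroup Γ] [TopologicalSpace Γ] (s : Scale Γ)
    {X : Type*} [MetricSpace X] (e : X) (mul : X → X → X) (inv : X → X) (dil : Γ → X → X)
    (nrm : X → ℝ) (O : Set X) : Prop where
  isOpen : IsOpen O
  mem : e ∈ O
  one_mul : ∀ u ∈ O, mul e u = u
  mul_one : ∀ u ∈ O, mul u e = u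
  mul_inv : ∀ u ∈ O, mul u (inv u) = e
  inv_mul : ∀ u ∈ O, mul (inv u) u = e
  assoc : ∀ u ∈ O, ∀ v ∈ O, ∀ w ∈ O, mul (mul u v) w = mul u (mul v w)
  mul_unif : UniformContinuousOn (fun p : X × X => mul p.1 p.2) (O ×ˢ O)
  inv_unif : UniformContinuousOn inv O
  dil_one : ∀ u ∈ O, dil 1 u = u
  dil_mul : ∀ ε μ : Γ, ∀ᶠ u in 𝓝 e, dil ε (dil μ u) = dil (ε * μ) u
  dil_cont : ContinuousOn (fun p : Γ × X => dil p.1 p.2) ({ε | s.ν ε ≤ 1} ×ˢ O)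
  dil_morphism : ∀ ε, s.ν ε ≤ 1 → ∀ u ∈ O, ∀ v ∈ O,
    dil ε (mul u v) = mul (dil ε u) (dil ε v)
  dil_tendsto : ∀ u ∈ O, Tendsto (fun ε => dil ε u) s.toZero (𝓝 e)
  nrm_cont : ContinuousOn nrm O
  nrm_nonneg : ∀ u ∈ O, 0 ≤ nrm u
  nrm_eq_zero : ∀ u ∈ O, nrm u = 0 → u = e
  nrm_mul : ∀ u ∈ O, ∀ v ∈ O, nrm (mul u v) ≤ nrm u + nrm v
  nrm_inv : ∀ u ∈ O, nrm (inv u) = nrm u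
  nrm_dil : ∀ ε, s.ν ε ≤ 1 → ∀ u ∈ O, nrm (dil ε u) = s.ν ε * nrm u

/-- The dilatations `u · δ_μ (u⁻¹ · v)` of a group with dilatations. -/
def groupDil {Γ X : Type*} (mul : X → X → X) (inv : X → X) (dil : Γ → X → X)
    (μ : Γ) (u v : X) : X :=
  mul u (dil μ (mul (inv u) v))

/-- The left invariant distance `‖u⁻¹ · v‖` of a normed group. -/
def groupDist {X : Type*} (mul : X → X → X) (inv : X → X) (nrm : X → ℝ) (u v : X) : ℝ :=
  nrm (mul (inv u) v)

namespace DilatationStructure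

variable {Γ : Type*} [CommGroup Γ] [TopologicalSpace Γ] {s : Scale Γ}
  {X : Type*} [MetricSpace X] (S : DilatationStructure s X)

/-- The difference `Δ^x_ε(u, v)`, the dilatation of coefficient `ε⁻¹` based at `δ^x_ε u` of
`δ^x_ε v`. -/
def diff (ε : Γ) (x u v : X) : X := S.δ ε⁻¹ (S.δ ε x u) (S.δ ε x v)

/-- The sum `Σ^x_ε(u, v)`, the dilatation of coefficient `ε⁻¹` based at `x` of the dilatation of
coefficient `ε` based at `δ^x_ε u` of `v`. -/
def sum (ε : Γ) (x u v : X) : X := S.δ ε⁻¹ x (S.δ ε (S.δ ε x u) v)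

/-- The inverse `inv^x_ε(u)`, the dilatation of coefficient `ε⁻¹` based at `δ^x_ε u` of `x`. -/
def inv (ε : Γ) (x u : X) : X := S.δ ε⁻¹ (S.δ ε x u) x

/-- `Δ^x(u, v) = lim_{ε → 0} Δ^x_ε(u, v)`. -/
noncomputable def diffLim (x u v : X) : X :=
  haveI : Nonempty X := ⟨x⟩
  limUnder s.toZero fun ε => S.diff ε x u v

/-- `Σ^x(u, v) = lim_{ε → 0} Σ^x_ε(u, v)`. -/
noncomputable def sumLim (x u v : X) : X :=
  haveI : Nonempty X := ⟨x⟩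
  limUnder s.toZero fun ε => S.sum ε x u v

/-- `inv^x(u) = lim_{ε → 0} inv^x_ε(u)`. -/
noncomputable def invLim (x u : X) : X :=
  haveI : Nonempty X := ⟨x⟩
  limUnder s.toZero fun ε => S.inv ε x u

/-- The distance `d^x`. -/
noncomputable def tdist (x u v : X) : ℝ := s.tangentDist S.δ x u v

/-- The norm `‖u‖ = d^x(x, u)` of the tangent space at `x`. -/
noncomputable def tnorm (x u : X) : ℝ := S.tdist x x u

/-- The set where `δ^x_ε` is defined. -/
def dom (ε : Γ) (x : X) : Set X :=
  {y | (s.ν ε ≤ 1 → y ∈ S.U x) ∧ (1 < s.ν ε → y ∈ S.W ε x)}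

/-- The expression `Δ^x_ε(u, v)` makes sense, for `ν ε ≤ 1`. -/
def DiffDefined (ε : Γ) (x u v : X) : Prop :=
  u ∈ S.U x ∧ v ∈ S.U x ∧ S.δ ε x v ∈ S.dom ε⁻¹ (S.δ ε x u)

/-- Axiom A4: `Δ^x_ε(u, v)` converges to `Δ^x(u, v)` as `ε → 0`, uniformly with respect to `x` in a
compact set and to `u, v` in the ball `closedBall x R`, with `R` depending on the compact set. -/
def IsStrong : Prop :=
  ∀ K : Set X, IsCompact K → ∃ R : ℝ, 0 < R ∧
    TendstoUniformlyOn (fun ε (p : X × X × X) => S.diff ε p.1 p.2.1 p.2.2)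
      (fun p => S.diffLim p.1 p.2.1 p.2.2) s.toZero
      {p | p.1 ∈ K ∧ p.2.1 ∈ closedBall p.1 R ∧ p.2.2 ∈ closedBall p.1 R}

/-- Linearity of a dilatation structure: the dilatations commute, as in the last line, for all
sufficiently close `x, y, z` and all coefficients in `Γ₁`. -/
def IsLinear : Prop :=
  ∀ K : Set X, IsCompact K → K.Nonempty → ∃ C : ℝ, 0 < C ∧
    ∀ x ∈ K, ∀ y ∈ K, ∀ z ∈ K, dist x y ≤ C → dist x z ≤ C → dist y z ≤ C →
      ∀ ε μ, s.ν ε ≤ 1 → s.ν μ ≤ 1 →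
        S.δ ε x (S.δ μ y z) = S.δ μ (S.δ ε x y) (S.δ ε x z)

/-- `f`, considered on `D`, is a linear transformation: it is Lipschitz and it commutes with
dilatations. -/
def IsLinearOn (D : Set X) (f : X → X) : Prop :=
  (∃ L : ℝ≥0, LipschitzOnWith L f D) ∧
    ∀ y ∈ D, ∀ v ∈ D, v ∈ S.U y → ∀ μ, s.ν μ ≤ 1 → f v ∈ S.U (f y) →
      f (S.δ μ y v) = S.δ μ (f y) (f v)

/-- The tangent space `T_x X`, with operation `Σ^x`, inverse `inv^x`, dilatations `δ^x` and norm
`d^x(x, ·)`, is well defined and a normed local conical group on the neighbourhood `O` of `x`;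
in this group `u⁻¹ · v` is `Δ^x(u, v)`. -/
structure IsTangentGroupOn (x : X) (O : Set X) : Prop where
  subset_U : O ⊆ S.U x
  tendsto_diff : ∀ u ∈ O, ∀ v ∈ O,
    Tendsto (fun ε => S.diff ε x u v) s.toZero (𝓝 (S.diffLim x u v))
  tendsto_sum : ∀ u ∈ O, ∀ v ∈ O,
    Tendsto (fun ε => S.sum ε x u v) s.toZero (𝓝 (S.sumLim x u v))
  tendsto_inv : ∀ u ∈ O, Tendsto (fun ε => S.inv ε x u) s.toZero (𝓝 (S.invLim x u))
  group : IsNormedLocalConicalGroup s x (S.sumLim x) (S.invLim x) (fun ε => S.δ ε x)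
    (S.tnorm x) O
  diff_eq : ∀ u ∈ O, ∀ v ∈ O, S.diffLim x u v = S.sumLim x (S.invLim x u) v

/-- On the closure of the open neighbourhood `D` of `x`, the distance `d^x` and the dilatations
`δ` are those of the tangent group `T_x X`, all the products involved being taken in a neighbourhood
`O` of `x` where `T_x X` is a normed local conical group. -/
structure AgreesWithTangentGroup (x : X) (O D : Set X) : Prop where
  tangent : S.IsTangentGroupOn x O
  isOpen : IsOpen D
  mem : x ∈ D
  closure_subset : closure D ⊆ O
  inv_mem : ∀ u ∈ closure D, S.invLim x u ∈ O
  diff_mem : ∀ u ∈ closure D, ∀ v ∈ closure D, S.diffLim x u v ∈ O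
  dil_mem : ∀ u ∈ closure D, ∀ v ∈ closure D, ∀ μ, s.ν μ ≤ 1 → S.δ μ x (S.diffLim x u v) ∈ O
  mem_U : ∀ u ∈ closure D, ∀ v ∈ closure D, v ∈ S.U u
  dist_eq : ∀ u ∈ closure D, ∀ v ∈ closure D,
    S.tdist x u v = groupDist (S.sumLim x) (S.invLim x) (S.tnorm x) u v
  dil_eq : ∀ u ∈ closure D, ∀ v ∈ closure D, ∀ μ, s.ν μ ≤ 1 →
    S.δ μ u v = groupDil (S.sumLim x) (S.invLim x) (fun ε => S.δ ε x) μ u v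
  dil_eq_sum_diff : ∀ u ∈ closure D, ∀ v ∈ closure D, ∀ μ, s.ν μ ≤ 1 →
    S.δ μ u v = S.sumLim x u (S.δ μ x (S.diffLim x u v))

end DilatationStructure

end Dilatation

/-!
The parameters `ε ∈ Γ₁` do not range over a compact set, nor are the closed balls of radius `A`
compact, so that the estimates near a point which are uniform in `ε` do not come from continuity.
They come from the homogeneity `d^x(δ^x_ε u, δ^x_ε v) = ν(ε) d^x(u, v)`, combined with the inclusion
`ball x (ν μ) ⊆ δ^x_μ (ball x A)` and the injectivity of `δ^x_μ`: a point of the unit ball of `d^x`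
stays in `ball x A` under all dilatations of `Γ₁` (`dil_mem_ball`), and `d^x`-small points are close
to `x` (`exists_dist_lt_of_tdist_lt`). It follows that `δ^x_ε u` and `Δ^x_ε(u, v)` are defined and
stay near a given point, uniformly in `ε`, for `x, u, v` near this point (`exists_dil_mem_ball`,
`exists_diff_spec`).

In a linear structure the maps `δ^x_ε` commute with dilatations, and so does
`Δ^x_ε(u, ·) = δ_{ε⁻¹} δ^x_ε`, the first dilatation being based at `δ^x_ε u`. A map which commutes
with dilatations is Lipschitz (`exists_lipschitzOnWith`), since by rescaling it is enough to bound
the distance of the images of points at a distance of order one.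

In a strong structure, the differences converge locally uniformly, hence in the sense of continuous
convergence, and identities between differences pass to the limit. The limit `D = Δ^e` satisfies
`D(e, u) = u`, `D(u, u) = e` and `D(D(u, v), D(u, w)) = D(v, w)`; these say that `D(u, v)` is `u⁻¹ v`
in a local group with inverse `D(u, e)` and operation `D(D(u, e), v)` (`IsLocalDivision`). The sums
converge to this operation because `Σ^e_ε(u, v)` is the difference, based at `δ^e_ε u`, of
`inv^e_ε(u)` and `v`. The dilatations `δ^e` are morphisms and `d^e(u, v) = ‖D(u, v)‖`
(`IsStrong.exists_isDifferenceOn`), which makes the tangent space a normed local conical group.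

Finally `δ^u_μ v = u · δ^e_μ(u⁻¹ v)` means `D(u, δ^u_μ v) = δ^e_μ D(u, v)`. If the structure is
linear, this is the limit of the linearity of `Δ^e_ε(u, ·)`, as `Δ^e_ε(u, u)` converges to `e`.
Conversely, with this formula both `δ^x_ε δ^y_μ z` and the dilatation by `μ`, based at
`a = δ^x_ε y`, of `δ^x_ε z` have the image `δ^e_{εμ} D(y, z)` under `D(a, ·)`, since `Γ` is
commutative. This is linearity near `e`, and a Lebesgue number gives it on compact sets.
-/

/-! ### The filter `ε → 0` and uniform limits -/

namespace Dilatation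

namespace Scale

variable {Γ : Type*} [CommGroup Γ] [TopologicalSpace Γ] (s : Scale Γ)

theorem exists_lt {a : ℝ} (ha : 0 < a) : ∃ ε, s.ν ε < a := by
  obtain ⟨_, ⟨ε, rfl⟩, -, h⟩ := s.inf_eq_zero.exists_between ha
  exact ⟨ε, h⟩

theorem eventually_toZero {p : Γ → Prop} :
    (∀ᶠ ε in s.toZero, p ε) ↔ ∃ a : ℝ, 0 < a ∧ ∀ ε, s.ν ε < a → p ε := by
  rw [toZero, ((nhdsGT_basis (0 : ℝ)).comap s.ν).eventually_iff]
  refine exists_congr fun a => and_congr_right fun _ => ?_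
  exact ⟨fun h ε hε => h ⟨s.pos ε, hε⟩, fun h ε hε => h ε hε.2⟩

theorem eventually_lt {a : ℝ} (ha : 0 < a) : ∀ᶠ ε in s.toZero, s.ν ε < a :=
  s.eventually_toZero.2 ⟨a, ha, fun _ h => h⟩

instance : s.toZero.NeBot := by
  refine ⟨fun h => ?_⟩
  obtain ⟨a, ha, h⟩ := s.eventually_toZero.1 (h ▸ eventually_bot : ∀ᶠ _ in s.toZero, False)
  exact (s.exists_lt ha).elim h

theorem tendsto_mul_right (α : Γ) : Tendsto (fun μ => μ * α) s.toZero s.toZero := by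
  intro t ht
  obtain ⟨a, ha, h⟩ := s.eventually_toZero.1 (show ∀ᶠ ε in s.toZero, ε ∈ t from ht)
  refine s.eventually_toZero.2 ⟨a / s.ν α, div_pos ha (s.pos α), fun ε hε => h _ ?_⟩
  rw [map_mul]
  exact (lt_div_iff₀ (s.pos α)).1 hε

theorem map_inv (ε : Γ) : s.ν ε⁻¹ = (s.ν ε)⁻¹ :=
  eq_inv_of_mul_eq_one_left (by rw [← map_mul, inv_mul_cancel, map_one])

theorem map_mul_le_one {ε μ : Γ} (hε : s.ν ε ≤ 1) (hμ : s.ν μ ≤ 1) : s.ν (ε * μ) ≤ 1 := by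
  rw [map_mul]
  exact mul_le_one₀ hε (s.pos μ).le hμ

end Scale

/-- Continuous convergence: a uniform limit of continuous maps is continuous, and the maps
converge to it jointly in the parameter and the point. -/
theorem tendsto_prod_of_tendstoUniformlyOn {ι Y Z : Type*} [TopologicalSpace Y]
    [PseudoMetricSpace Z] {l : Filter ι} [l.NeBot] {F : ι → Y → Z} {f : Y → Z} {G : Set Y} {y : Y}
    (h : TendstoUniformlyOn F f l G) (hF : ∀ᶠ i in l, ContinuousOn (F i) G) (hG : G ∈ 𝓝 y) :
    ContinuousAt f y ∧ Tendsto (fun p : ι × Y => F p.1 p.2) (l ×ˢ 𝓝 y) (𝓝 (f y)) := by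
  have hf : ContinuousAt f y := (h.continuousOn hF.frequently).continuousAt hG
  refine ⟨hf, Metric.tendsto_nhds.2 fun η hη => ?_⟩
  have h1 := (Metric.tendstoUniformlyOn_iff.1 h (η / 2) (half_pos hη)).prod_mk
    (eventually_mem_set.2 hG)
  have h2 := (Metric.tendsto_nhds.1 hf (η / 2) (half_pos hη)).prod_inr l
  filter_upwards [h1, h2] with p hp hp'
  have h3 := hp.1 p.2 hp.2
  rw [dist_comm] at h3
  linarith [dist_triangle (F p.1 p.2) (f p.2) (f y)]

/-! ### The dilatations and the distances `d^x` -/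

namespace DilatationStructure

variable {Γ : Type*} [CommGroup Γ] [TopologicalSpace Γ] {s : Scale Γ}
  {X : Type*} [MetricSpace X] (S : DilatationStructure s X)

theorem A_pos : 0 < S.A := one_pos.trans S.one_lt_A

theorem ball_subset_U (x : X) : ball x S.A ⊆ S.U x :=
  ball_subset_closedBall.trans (S.closedBall_subset_U x)

theorem self_mem_closedBall (x : X) : x ∈ closedBall x S.A :=
  mem_closedBall_self S.A_pos.le

theorem dil_mem_V {ε : Γ} {x u : X} (h : s.ν ε ≤ 1) (hu : u ∈ S.U x) : S.δ ε x u ∈ S.V ε x := by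
  obtain ⟨e, h1, h2, h3⟩ := S.homeo ε x h
  rw [← h3 hu, ← h2]
  exact e.map_source (h1 ▸ hu)

theorem dil_mem_U {ε : Γ} {x u : X} (h : s.ν ε ≤ 1) (hu : u ∈ S.U x) : S.δ ε x u ∈ S.U x :=
  S.V_subset_U ε x h (S.dil_mem_V h hu)

theorem injOn_U {ε : Γ} (x : X) (h : s.ν ε ≤ 1) : InjOn (S.δ ε x) (S.U x) :=
  LeftInvOn.injOn fun u hu => S.inv_apply ε x h u hu

theorem continuousAt_dil {ε : Γ} {x u : X} (h : s.ν ε ≤ 1) (hu : u ∈ ball x S.A) :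
    ContinuousAt (fun q : X × X => S.δ ε q.1 q.2) (x, u) := by
  have hc : ContinuousOn (fun q : X × X => S.δ ε q.1 q.2) {q | q.2 ∈ ball q.1 S.A} :=
    S.continuousOn.comp (f := fun q : X × X => (ε, q.1, q.2)) (by fun_prop) fun q hq =>
      ⟨fun _ => S.ball_subset_U _ hq, fun h' => absurd h' h.not_gt⟩
  refine hc.continuousAt (IsOpen.mem_nhds ?_ hu)
  exact isOpen_lt (continuous_snd.dist continuous_fst) continuous_const

/-- Axiom A2 also holds for `γ ∉ Γ₁`, as long as `μ` and `γμ` are in `Γ₁`. -/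
theorem dil_dil {γ μ : Γ} {x u : X} (hμ : s.ν μ ≤ 1) (h : s.ν (γ * μ) ≤ 1)
    (hu : u ∈ closedBall x S.A) : S.δ γ x (S.δ μ x u) = S.δ (γ * μ) x u := by
  rcases le_or_gt (s.ν γ) 1 with hγ | hγ
  · exact S.mul_apply γ μ x hγ hμ u hu
  · have hγ' : s.ν γ⁻¹ ≤ 1 := by
      rw [s.map_inv]
      exact inv_le_one_of_one_le₀ hγ.le
    have h1 := S.mul_apply γ⁻¹ (γ * μ) x hγ' h u hu
    rw [inv_mul_cancel_left] at h1
    have h2 := S.inv_apply γ⁻¹ x hγ' _ (S.dil_mem_U h (S.closedBall_subset_U x hu))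
    rwa [inv_inv, h1] at h2

theorem tendsto_tdist {x u v : X} (hu : u ∈ closedBall x S.A) (hv : v ∈ closedBall x S.A) :
    Tendsto (fun ε => dist (S.δ ε x u) (S.δ ε x v) / s.ν ε) s.toZero (𝓝 (S.tdist x u v)) :=
  (S.tangentDist_unif {x} isCompact_singleton).tendsto_at (x := (x, u, v)) ⟨rfl, hu, hv⟩

theorem tdist_nonneg {x u v : X} (hu : u ∈ closedBall x S.A) (hv : v ∈ closedBall x S.A) :
    0 ≤ S.tdist x u v :=
  ge_of_tendsto' (S.tendsto_tdist hu hv) fun ε => div_nonneg dist_nonneg (s.pos ε).le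

theorem tdist_comm (x u v : X) : S.tdist x u v = S.tdist x v u := by
  simp only [tdist, Scale.tangentDist, dist_comm]

theorem tdist_triangle {x u v w : X} (hu : u ∈ closedBall x S.A) (hv : v ∈ closedBall x S.A)
    (hw : w ∈ closedBall x S.A) : S.tdist x u w ≤ S.tdist x u v + S.tdist x v w := by
  refine le_of_tendsto_of_tendsto' (S.tendsto_tdist hu hw)
    ((S.tendsto_tdist hu hv).add (S.tendsto_tdist hv hw)) fun ε => ?_
  rw [← add_div]
  exact div_le_div_of_nonneg_right (dist_triangle _ _ _) (s.pos ε).le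

theorem tdist_self {x u : X} (hu : u ∈ closedBall x S.A) : S.tdist x u u = 0 :=
  tendsto_nhds_unique (S.tendsto_tdist hu hu) (by simp)

/-- `d^x` is homogeneous for the dilatations based at `x`. -/
theorem tdist_dil {ε : Γ} {x u v : X} (hε : s.ν ε ≤ 1) (hu : u ∈ closedBall x S.A)
    (hv : v ∈ closedBall x S.A) (hu' : S.δ ε x u ∈ closedBall x S.A)
    (hv' : S.δ ε x v ∈ closedBall x S.A) :
    S.tdist x (S.δ ε x u) (S.δ ε x v) = s.ν ε * S.tdist x u v := by
  have h := ((S.tendsto_tdist hu hv).comp (s.tendsto_mul_right ε)).const_mul (s.ν ε)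
  refine tendsto_nhds_unique ((S.tendsto_tdist hu' hv').congr' ?_) h
  filter_upwards [s.eventually_lt one_pos] with μ hμ
  have h1 := (s.pos ε).ne'
  have h2 := (s.pos μ).ne'
  simp only [Function.comp_apply, S.mul_apply μ ε x hμ.le hε u hu,
    S.mul_apply μ ε x hμ.le hε v hv, map_mul]
  field_simp

theorem tdist_base_dil {ε : Γ} {x u : X} (hε : s.ν ε ≤ 1) (hu : u ∈ closedBall x S.A)
    (hu' : S.δ ε x u ∈ closedBall x S.A) :
    S.tdist x x (S.δ ε x u) = s.ν ε * S.tdist x x u := by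
  have hx := S.self_mem_closedBall x
  have h := S.tdist_dil hε hx hu (by rwa [S.apply_self]) hu'
  rwa [S.apply_self] at h

/-- The dilatations of coefficient in `Γ₁` do not leave `ball x A` when they are applied to points
of the unit ball of `d^x`. No compactness of `Γ₁` is available here: the point is that a further
dilatation of small coefficient `μ` brings `δ^x_ε u` to a distance less than `ν(μ)` of `x`, hence
into `δ^x_μ (ball x A)`, and `δ^x_μ` is injective. -/
theorem dil_mem_ball {ε : Γ} {x u : X} (hε : s.ν ε ≤ 1) (hu : u ∈ closedBall x S.A)
    (h : S.tdist x x u < 1) : S.δ ε x u ∈ ball x S.A := by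
  have h1 := ((S.tendsto_tdist (S.self_mem_closedBall x) hu).comp
    (s.tendsto_mul_right ε)).eventually_lt_const h
  obtain ⟨μ, h2, hμ⟩ := (h1.and (s.eventually_lt one_pos)).exists
  simp only [Function.comp_apply, S.apply_self] at h2
  rw [div_lt_one (s.pos _), ← S.mul_apply μ ε x hμ.le hε u hu, map_mul] at h2
  obtain ⟨y, hy, hyu⟩ := S.ball_subset_image μ x hμ (show S.δ μ x (S.δ ε x u) ∈ ball x (s.ν μ) by
    rw [mem_ball']
    exact h2.trans_le (mul_le_of_le_one_right (s.pos μ).le hε))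
  rwa [← S.injOn_U x hμ.le (S.ball_subset_U x hy)
    (S.dil_mem_U hε (S.closedBall_subset_U x hu)) hyu]

/-- A point at `d^x`-distance less than `ν(α)` from `x` is of the form `δ^x_α y`. -/
theorem exists_dil_eq {α : Γ} {x w : X} (hα : s.ν α < 1) (hw : w ∈ closedBall x S.A)
    (h : S.tdist x x w < s.ν α) : ∃ y ∈ ball x S.A, S.δ α x y = w := by
  have h1 := (S.tendsto_tdist (S.self_mem_closedBall x) hw).eventually_lt_const h
  obtain ⟨μ, h2, hμ⟩ := (h1.and (s.eventually_lt one_pos)).exists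
  rw [S.apply_self, div_lt_iff₀ (s.pos μ), mul_comm, ← map_mul] at h2
  have h3 : s.ν (μ * α) < 1 := by
    rw [map_mul]
    exact mul_lt_one_of_nonneg_of_lt_one_left (s.pos μ).le hμ hα.le
  obtain ⟨y, hy, hyw⟩ := S.ball_subset_image (μ * α) x h3 (mem_ball'.2 h2)
  refine ⟨y, hy, ?_⟩
  rw [← S.mul_apply μ α x hμ.le hα.le y (ball_subset_closedBall hy)] at hyw
  exact S.injOn_U x hμ.le (S.dil_mem_U hα.le (S.ball_subset_U x hy))
    (S.closedBall_subset_U x hw) hyw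

end DilatationStructure

namespace DilatationStructure

variable {Γ : Type*} [CommGroup Γ] [TopologicalSpace Γ] {s : Scale Γ}
  {X : Type*} [MetricSpace X] (S : DilatationStructure s X)

/-! ### Estimates near a point, uniform in the coefficient -/

theorem mem_closedBall_A {x₀ x u : X} (hx : x ∈ ball x₀ (1 / 2)) (hu : u ∈ ball x₀ (1 / 2)) :
    u ∈ closedBall x S.A := by
  rw [mem_ball] at hx hu
  have := dist_triangle_right u x x₀
  have := S.one_lt_A
  rw [mem_closedBall]
  linarith

theorem mem_ball_A {x₀ x u : X} (hx : x ∈ ball x₀ (1 / 2)) (hu : u ∈ ball x₀ (1 / 2)) :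
    u ∈ ball x S.A := by
  rw [mem_ball] at hx hu ⊢
  have := dist_triangle_right u x x₀
  have := S.one_lt_A
  linarith

variable [LocallyCompactSpace X]

/-- Axiom A3 near a point. -/
theorem exists_abs_lt (x₀ : X) {η : ℝ} (hη : 0 < η) :
    ∃ r : ℝ, 0 < r ∧ ∃ a : ℝ, 0 < a ∧ ∀ ε, s.ν ε < a → ∀ x ∈ ball x₀ r,
      ∀ u ∈ closedBall x S.A, ∀ v ∈ closedBall x S.A,
        |dist (S.δ ε x u) (S.δ ε x v) / s.ν ε - S.tdist x u v| < η := by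
  obtain ⟨K, hK, hxK⟩ := exists_compact_mem_nhds x₀
  obtain ⟨r, hr, hrK⟩ := Metric.mem_nhds_iff.1 hxK
  obtain ⟨a, ha, h⟩ := s.eventually_toZero.1
    (Metric.tendstoUniformlyOn_iff.1 (S.tangentDist_unif K hK) η hη)
  refine ⟨r, hr, a, ha, fun ε hε x hx u hu v hv => ?_⟩
  have := h ε hε (x, u, v) ⟨hrK hx, hu, hv⟩
  rwa [dist_comm] at this

/-- `d^x(u, v)` is continuous in `(x, u, v)`, and it is a limit in the sense of continuous
convergence. -/
theorem tendsto_prod_tdist {x u v : X} (hu : u ∈ ball x S.A) (hv : v ∈ ball x S.A) :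
    ContinuousAt (fun q : X × X × X => S.tdist q.1 q.2.1 q.2.2) (x, u, v) ∧
    Tendsto (fun p : Γ × X × X × X =>
        dist (S.δ p.1 p.2.1 p.2.2.1) (S.δ p.1 p.2.1 p.2.2.2) / s.ν p.1)
      (s.toZero ×ˢ 𝓝 (x, u, v)) (𝓝 (S.tdist x u v)) := by
  obtain ⟨K, hK, hxK⟩ := exists_compact_mem_nhds x
  set G : Set (X × X × X) :=
    {q | q.1 ∈ K ∧ q.2.1 ∈ ball q.1 S.A ∧ q.2.2 ∈ ball q.1 S.A} with hG
  have hunif := (S.tangentDist_unif K hK).mono (s' := G) fun q hq =>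
    ⟨hq.1, ball_subset_closedBall hq.2.1, ball_subset_closedBall hq.2.2⟩
  refine tendsto_prod_of_tendstoUniformlyOn (y := (x, u, v)) hunif ?_ ?_
  · filter_upwards [s.eventually_lt one_pos] with ε hε q hq
    refine ContinuousAt.continuousWithinAt ?_
    have h1 : ContinuousAt (fun q : X × X × X => S.δ ε q.1 q.2.1) q :=
      ContinuousAt.comp (f := fun q : X × X × X => (q.1, q.2.1))
        (S.continuousAt_dil hε.le hq.2.1) (by fun_prop)
    have h2 : ContinuousAt (fun q : X × X × X => S.δ ε q.1 q.2.2) q :=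
      ContinuousAt.comp (f := fun q : X × X × X => (q.1, q.2.2))
        (S.continuousAt_dil hε.le hq.2.2) (by fun_prop)
    exact (h1.dist h2).div_const _
  · have h1 : ∀ᶠ q : X × X × X in 𝓝 (x, u, v), q.1 ∈ K := continuousAt_fst.eventually_mem hxK
    have h2 : ∀ᶠ q : X × X × X in 𝓝 (x, u, v), dist q.2.1 q.1 < S.A :=
      (isOpen_lt (by fun_prop) continuous_const).mem_nhds hu
    have h3 : ∀ᶠ q : X × X × X in 𝓝 (x, u, v), dist q.2.2 q.1 < S.A :=
      (isOpen_lt (by fun_prop) continuous_const).mem_nhds hv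
    filter_upwards [h1, h2, h3] with q h1 h2 h3 using ⟨h1, h2, h3⟩

theorem exists_tdist_lt (x₀ : X) {η : ℝ} (hη : 0 < η) :
    ∃ r : ℝ, 0 < r ∧ ∀ x ∈ ball x₀ r, ∀ u ∈ ball x₀ r, ∀ v ∈ ball x₀ r, S.tdist x u v < η := by
  have h0 := mem_ball_self (x := x₀) S.A_pos
  have h := (S.tendsto_prod_tdist h0 h0).1.eventually_lt_const (u := η)
    (by simpa [S.tdist_self (S.self_mem_closedBall x₀)] using hη)
  obtain ⟨r, hr, h⟩ := Metric.eventually_nhds_iff_ball.1 h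
  refine ⟨r, hr, fun x hx u hu v hv => h (x, u, v) ?_⟩
  rw [← ball_prod_same, ← ball_prod_same]
  exact ⟨hx, hu, hv⟩

/-- A point of `closedBall x A` at a small `d^x`-distance of `x` is close to `x`. As
`closedBall x A` may fail to be compact, this does not follow from nondegeneracy: such a point is
`δ^x_α y` with `d^x(x, y) < 1`, and `d(x, δ^x_α y)` is about `ν(α) d^x(x, y)`. -/
theorem exists_dist_lt_of_tdist_lt (x₀ : X) {ρ : ℝ} (hρ : 0 < ρ) :
    ∃ r : ℝ, 0 < r ∧ ∃ c : ℝ, 0 < c ∧ ∀ x ∈ ball x₀ r, ∀ w ∈ closedBall x S.A,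
      S.tdist x x w < c → dist x w < ρ := by
  obtain ⟨r, hr, a, ha, h⟩ := S.exists_abs_lt x₀ one_pos
  obtain ⟨α, hα⟩ := s.exists_lt (show 0 < min (min a 1) (ρ / 2) by positivity)
  simp only [lt_min_iff] at hα
  refine ⟨r, hr, s.ν α, s.pos α, fun x hx w hw hwα => ?_⟩
  obtain ⟨y, hy, rfl⟩ := S.exists_dil_eq hα.1.2 hw hwα
  have hy' := ball_subset_closedBall hy
  have h1 := (abs_lt.1 (h α hα.1.1 x hx x (S.self_mem_closedBall x) y hy')).2
  rw [S.tdist_base_dil hα.1.2.le hy' hw] at hwα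
  have h2 : S.tdist x x y < 1 := by
    by_contra! h2
    nlinarith [s.pos α]
  rw [S.apply_self, sub_lt_iff_lt_add, div_lt_iff₀ (s.pos α)] at h1
  nlinarith [s.pos α]

/-- The dilatations of coefficient in `Γ₁` are equicontinuous at their base point. -/
theorem exists_dil_mem_ball (x₀ : X) {ρ : ℝ} (hρ : 0 < ρ) :
    ∃ r : ℝ, 0 < r ∧ ∀ x ∈ ball x₀ r, ∀ u ∈ ball x₀ r, ∀ ε, s.ν ε ≤ 1 →
      S.δ ε x u ∈ ball x₀ ρ := by
  obtain ⟨r₁, hr₁, c, hc, h₁⟩ := S.exists_dist_lt_of_tdist_lt x₀ (half_pos hρ)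
  obtain ⟨r₂, hr₂, h₂⟩ := S.exists_tdist_lt x₀ (lt_min hc one_pos)
  refine ⟨min (min r₁ r₂) (min (1 / 2) (ρ / 2)), by positivity, fun x hx u hu ε hε => ?_⟩
  simp only [mem_ball, lt_min_iff] at hx hu
  have hu' : u ∈ closedBall x S.A := S.mem_closedBall_A hx.2.1 hu.2.1
  have h3 := lt_min_iff.1 (h₂ x hx.1.2 x hx.1.2 u hu.1.2)
  have h4 := ball_subset_closedBall (S.dil_mem_ball hε hu' h3.2)
  have h5 := h₁ x hx.1.1 _ h4 (by
    rw [S.tdist_base_dil hε hu' h4]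
    exact (mul_le_of_le_one_left (S.tdist_nonneg (S.self_mem_closedBall x) hu') hε).trans_lt h3.1)
  rw [dist_comm] at h5
  rw [mem_ball]
  linarith [dist_triangle (S.δ ε x u) x x₀]

/-- For all `ε ∈ Γ₁`, the difference `Δ^x_ε(u, v)` is defined near the diagonal; it is close to the
diagonal, and it solves the equation which defines it. -/
theorem exists_diff_spec (x₀ : X) {ρ : ℝ} (hρ : 0 < ρ) :
    ∃ r : ℝ, 0 < r ∧ ∀ x ∈ ball x₀ r, ∀ u ∈ ball x₀ r, ∀ v ∈ ball x₀ r, ∀ ε, s.ν ε ≤ 1 →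
      S.DiffDefined ε x u v ∧ S.diff ε x u v ∈ ball x₀ ρ ∧
        S.δ ε (S.δ ε x u) (S.diff ε x u v) = S.δ ε x v := by
  obtain ⟨ρ₁, hρ₁, c, hc, h₁⟩ := S.exists_dist_lt_of_tdist_lt x₀ (half_pos hρ)
  -- `η` is such that `3 * η ≤ c` and `2 * η ≤ 1`
  set η : ℝ := min (c / 3) (1 / 2) with hη_def
  have hη : 0 < η := by positivity
  have hηc : 3 * η ≤ c := by linarith [min_le_left (c / 3) (1 / 2 : ℝ)]
  have hη1 : 2 * η ≤ 1 := by linarith [min_le_right (c / 3) (1 / 2 : ℝ)]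
  obtain ⟨ρ₂, hρ₂, a, ha, h₂⟩ := S.exists_abs_lt x₀ hη
  obtain ⟨ρ₃, hρ₃, h₃⟩ := S.exists_tdist_lt x₀ (show 0 < min η (c * a) by positivity)
  obtain ⟨ρ₄, hρ₄, h₄⟩ := S.exists_dil_mem_ball x₀ hρ
  obtain ⟨r, hr, h₅⟩ := S.exists_dil_mem_ball x₀
    (show 0 < min (min (min ρ₁ ρ₂) (min ρ₃ ρ₄)) (min (min (a / 2) (1 / 2)) (ρ / 2)) by positivity)
  refine ⟨min r (min (min ρ₂ ρ₃) (1 / 2)), by positivity, fun x hx u hu v hv ε hε => ?_⟩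
  simp only [mem_ball, lt_min_iff] at hx hu hv h₅
  have hxu : u ∈ closedBall x S.A := S.mem_closedBall_A hx.2.2 hu.2.2
  have hxv : v ∈ closedBall x S.A := S.mem_closedBall_A hx.2.2 hv.2.2
  have hu5 := h₅ x hx.1 u hu.1 ε hε
  have hv5 := h₅ x hx.1 v hv.1 ε hε
  have hd : S.tdist x u v < η := (h₃ x hx.2.1.2 u hu.2.1.2 v hv.2.1.2).trans_le (min_le_left _ _)
  unfold DiffDefined diff
  set x' := S.δ ε x u with hx'
  set y' := S.δ ε x v with hy'
  have hx'y' : y' ∈ ball x' S.A := S.mem_ball_A hu5.2.1.2 hv5.2.1.2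
  rcases hε.lt_or_eq with hε1 | hε1
  · have hsmall : s.ν ε < a → dist x' y' < s.ν ε * (2 * η) := fun hεa => by
      have h6 := (abs_lt.1 (h₂ ε hεa x hx.2.1.1 u hxu v hxv)).2
      rw [sub_lt_iff_lt_add, div_lt_iff₀ (s.pos ε)] at h6
      nlinarith [s.pos ε]
    have hdist : y' ∈ ball x' (s.ν ε) := by
      rw [mem_ball']
      rcases lt_or_ge (s.ν ε) a with hεa | hεa
      · exact (hsmall hεa).trans_le (mul_le_of_le_one_right (s.pos ε).le hη1)
      · linarith [dist_triangle_right x' y' x₀, hu5.2.1.1, hv5.2.1.1]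
    obtain ⟨z, hz, hzy⟩ := S.ball_subset_image ε x' hε1 hdist
    have hzU := S.ball_subset_U x' hz
    have hzA := ball_subset_closedBall hz
    have hinv : S.δ ε⁻¹ x' y' = z := by rw [← hzy, S.inv_apply ε x' hε z hzU]
    have hε1' : 1 < s.ν ε⁻¹ := by
      rw [s.map_inv]
      exact (one_lt_inv₀ (s.pos ε)).2 hε1
    rw [hinv]
    refine ⟨⟨S.closedBall_subset_U x hxu, S.closedBall_subset_U x hxv,
      fun h => absurd h hε1'.not_ge, fun h => S.V_subset_W _ _ h ?_⟩, ?_, hzy⟩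
    · rw [inv_inv, ← hzy]
      exact S.dil_mem_V hε hzU
    · have hzc : S.tdist x' x' z < c := by
        rcases lt_or_ge (s.ν ε) a with hεa | hεa
        · have h6 := (abs_lt.1 (h₂ ε hεa x' hu5.1.1.2 x' (S.self_mem_closedBall x') z hzA)).1
          rw [S.apply_self, hzy] at h6
          have h7 : dist x' y' / s.ν ε < 2 * η := by
            rw [div_lt_iff₀ (s.pos ε)]
            linarith [hsmall hεa]
          linarith
        · have h6 := (h₃ x' hu5.1.2.1 x' hu5.1.2.1 y' hv5.1.2.1).trans_le (min_le_right _ _)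
          rw [← hzy, S.tdist_base_dil hε hzA (hzy ▸ ball_subset_closedBall hx'y')] at h6
          by_contra! h7
          nlinarith [mul_le_mul h7 hεa ha.le (hc.le.trans h7)]
      have h6 := h₁ x' hu5.1.1.1 z hzA hzc
      rw [dist_comm] at h6
      rw [mem_ball]
      linarith [dist_triangle z x' x₀, hu5.2.2]
  · have hε1' : s.ν ε⁻¹ = 1 := by rw [s.map_inv, hε1, inv_one]
    refine ⟨⟨S.closedBall_subset_U x hxu, S.closedBall_subset_U x hxv,
      fun _ => S.ball_subset_U x' hx'y', fun h => absurd hε1' h.ne'⟩,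
      h₄ x' hu5.1.2.2 y' hv5.1.2.2 ε⁻¹ hε1'.le, ?_⟩
    rw [S.mul_apply ε ε⁻¹ x' hε hε1'.le y' (ball_subset_closedBall hx'y'), mul_inv_cancel,
      S.one_apply x' y' (S.ball_subset_U x' hx'y')]

/-- A map which commutes with the dilatations near a point is Lipschitz there: two close points
are `y` and `δ^y_μ z` with `z` at a `d^y`-distance of `y` bounded below, their distance is
comparable to `ν(μ)`, and the distance of their images is at most a multiple of `ν(μ)`. -/
theorem exists_lipschitzOnWith (x₀ : X) :
    ∃ ρ : ℝ, 0 < ρ ∧ ∀ r : ℝ, 0 < r → ∃ r' : ℝ, 0 < r' ∧ ∃ L : ℝ≥0, ∀ f : X → X,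
      (∀ y ∈ ball x₀ r, f y ∈ ball x₀ ρ) →
      (∀ y ∈ ball x₀ r, ∀ v ∈ ball x₀ r, ∀ μ, s.ν μ ≤ 1 →
        f (S.δ μ y v) = S.δ μ (f y) (f v)) →
      LipschitzOnWith L f (ball x₀ r') := by
  obtain ⟨ρ₁, hρ₁, a₁, ha₁, h₁⟩ := S.exists_abs_lt x₀ one_pos
  obtain ⟨ρ₂, hρ₂, h₂⟩ := S.exists_tdist_lt x₀ one_pos
  refine ⟨min (min ρ₁ ρ₂) (1 / 2), by positivity, fun r hr => ?_⟩
  obtain ⟨r₁, hr₁, c, hc, h₃⟩ := S.exists_dist_lt_of_tdist_lt x₀ (half_pos hr)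
  obtain ⟨γ, hγ⟩ := s.exists_lt one_pos
  have hγ0 := s.pos γ
  obtain ⟨r₂, hr₂, a₂, ha₂, h₄⟩ := S.exists_abs_lt x₀ (show 0 < min c 1 / 2 * s.ν γ / 2 by positivity)
  set b : ℝ := min c 1 / 2 with hb
  have hb0 : 0 < b := by positivity
  have hbc : b < c := by linarith [min_le_left c 1]
  have hb1 : b < 1 := by linarith [min_le_right c 1]
  obtain ⟨r₃, hr₃, h₅⟩ := S.exists_tdist_lt x₀
    (show 0 < b * s.ν γ * min (min a₁ a₂) 1 by positivity)
  refine ⟨min (min r₁ r₂) (min r₃ (min (r / 2) (1 / 2))), by positivity,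
    (2 / (b * s.ν γ / 2)).toNNReal, fun f hf hfd => LipschitzOnWith.of_dist_le_mul ?_⟩
  rw [Real.coe_toNNReal _ (by positivity)]
  intro y hy z hz
  simp only [mem_ball, lt_min_iff] at hy hz
  have hyz : z ∈ closedBall y S.A := S.mem_closedBall_A hy.2.2.2 hz.2.2.2
  have hyy := S.self_mem_closedBall y
  rcases eq_or_ne y z with rfl | hne
  · simp
  set t := S.tdist y y z with ht
  have ht0 : 0 < t := (S.tdist_nonneg hyy hyz).lt_of_ne fun h =>
    hne (S.nondegenerate y y hyy z hyz h.symm)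
  have htlt : t < b * s.ν γ * min (min a₁ a₂) 1 := h₅ y hy.2.1 y hy.2.1 z hz.2.1
  -- the scale `μ = γ ^ n` is such that `b * ν γ * ν μ < t ≤ b * ν μ`
  have ht1 : t / b ≤ 1 := by
    rw [div_le_one hb0]
    calc t ≤ b * s.ν γ * min (min a₁ a₂) 1 := htlt.le
      _ ≤ b * 1 * 1 := by gcongr; exact min_le_right _ _
      _ = b := by ring
  obtain ⟨n, hn1, hn2⟩ := exists_nat_pow_near_of_lt_one (div_pos ht0 hb0) ht1 hγ0 hγ
  obtain ⟨μ, hμ⟩ : ∃ μ, s.ν μ = s.ν γ ^ n := ⟨γ ^ n, map_pow _ _ _⟩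
  rw [pow_succ, ← hμ, lt_div_iff₀ hb0] at hn1
  rw [← hμ, div_le_iff₀ hb0] at hn2
  have hμ0 := s.pos μ
  have hμa : s.ν μ < min (min a₁ a₂) 1 := by
    by_contra! h
    nlinarith [mul_le_mul_of_nonneg_left h (mul_pos hb0 hγ0).le]
  simp only [lt_min_iff] at hμa
  obtain ⟨z', hz', rfl⟩ := S.exists_dil_eq hμa.2 hyz (by nlinarith)
  have hz'A := ball_subset_closedBall hz'
  rw [ht, S.tdist_base_dil hμa.2.le hz'A hyz] at hn1 hn2
  have h6 : dist y z' < r / 2 := h₃ y hy.1.1 z' hz'A (by nlinarith)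
  have hyr : y ∈ ball x₀ r := by
    rw [mem_ball]
    linarith [hy.2.2.1]
  have hz'r : z' ∈ ball x₀ r := by
    rw [mem_ball]
    linarith [dist_triangle_left z' x₀ y, hy.2.2.1]
  have hfy := hf y hyr
  have hfz := hf z' hz'r
  simp only [mem_ball, lt_min_iff] at hfy hfz
  have h7 := (abs_lt.1 (h₄ μ hμa.1.2 y hy.1.2 y hyy z' hz'A)).1
  have h8 := (abs_lt.1 (h₁ μ hμa.1.1 (f y) hfy.1.1 (f y) (S.self_mem_closedBall _) (f z')
    (S.mem_closedBall_A hfy.2 hfz.2))).2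
  have h9 := h₂ (f y) hfy.1.2 (f y) hfy.1.2 (f z') hfz.1.2
  rw [S.apply_self, ← hfd y hyr z' hz'r μ hμa.2.le, sub_lt_iff_lt_add, div_lt_iff₀ hμ0] at h8
  have h10 : b * s.ν γ < S.tdist y y z' := by
    by_contra! h
    nlinarith [mul_le_mul_of_nonneg_left h hμ0.le]
  rw [S.apply_self] at h7
  have h11 : b * s.ν γ / 2 < dist y (S.δ μ y z') / s.ν μ := by linarith
  rw [lt_div_iff₀ hμ0] at h11
  have h12 : dist (f y) (f (S.δ μ y z')) ≤ 2 * s.ν μ := by nlinarith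
  have hbγ : 0 < b * s.ν γ / 2 := by positivity
  calc dist (f y) (f (S.δ μ y z')) ≤ 2 * s.ν μ := h12
    _ = 2 / (b * s.ν γ / 2) * (b * s.ν γ / 2 * s.ν μ) := by field_simp
    _ ≤ 2 / (b * s.ν γ / 2) * dist y (S.δ μ y z') := by gcongr

end DilatationStructure

namespace DilatationStructure

variable {Γ : Type*} [CommGroup Γ] [TopologicalSpace Γ] {s : Scale Γ}
  {X : Type*} [MetricSpace X] (S : DilatationStructure s X)

/-! ### Linear structures: the differences commute with dilatations -/

variable {S} in
theorem IsLinearOn.mono {D D' : Set X} {f : X → X} (h : S.IsLinearOn D f) (hD : D' ⊆ D) :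
    S.IsLinearOn D' f := by
  obtain ⟨⟨L, hL⟩, h'⟩ := h
  exact ⟨⟨L, hL.mono hD⟩, fun y hy v hv => h' y (hD hy) v (hD hv)⟩

/-- Linearity is a local property. -/
theorem isLinear_of_locally
    (h : ∀ x₀ : X, ∃ r : ℝ, 0 < r ∧ ∀ x ∈ ball x₀ r, ∀ y ∈ ball x₀ r, ∀ z ∈ ball x₀ r,
      ∀ ε μ, s.ν ε ≤ 1 → s.ν μ ≤ 1 →
        S.δ ε x (S.δ μ y z) = S.δ μ (S.δ ε x y) (S.δ ε x z)) : S.IsLinear := by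
  intro K hK _
  choose r hr h using h
  obtain ⟨C, hC, hCr⟩ := lebesgue_number_lemma_of_metric hK (fun p => isOpen_ball (x := p) (ε := r p))
    fun p _ => mem_iUnion.2 ⟨p, mem_ball_self (hr p)⟩
  refine ⟨C / 2, half_pos hC, fun x hx y _ z _ hxy hxz _ => ?_⟩
  obtain ⟨p, hp⟩ := hCr x hx
  refine h p x (hp (mem_ball_self hC)) y (hp ?_) z (hp ?_) <;> rw [mem_ball'] <;> linarith

variable [LocallyCompactSpace X]

variable {S} in
theorem IsLinear.exists_dil_dil (hL : S.IsLinear) (x₀ : X) :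
    ∃ r : ℝ, 0 < r ∧ ∀ x ∈ ball x₀ r, ∀ y ∈ ball x₀ r, ∀ z ∈ ball x₀ r,
      ∀ ε μ, s.ν ε ≤ 1 → s.ν μ ≤ 1 →
        S.δ ε x (S.δ μ y z) = S.δ μ (S.δ ε x y) (S.δ ε x z) := by
  obtain ⟨K, hK, hxK⟩ := exists_compact_mem_nhds x₀
  obtain ⟨r, hr, hrK⟩ := Metric.mem_nhds_iff.1 hxK
  obtain ⟨C, hC, h⟩ := hL K hK ⟨x₀, mem_of_mem_nhds hxK⟩
  refine ⟨min r (C / 2), by positivity, fun x hx y hy z hz => ?_⟩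
  rw [mem_ball, lt_min_iff] at hx hy hz
  refine h x (hrK hx.1) y (hrK hy.1) z (hrK hz.1) ?_ ?_ ?_
  · linarith [dist_triangle_right x y x₀]
  · linarith [dist_triangle_right x z x₀]
  · linarith [dist_triangle_right y z x₀]

variable {S} in
/-- In a linear structure, the map `Δ^x_ε(u, ·)` commutes with dilatations: by linearity, both
`δ^x_ε` and `δ_ε` based at `δ^x_ε u` do. -/
theorem IsLinear.exists_diff_dil (hL : S.IsLinear) (x₀ : X) :
    ∃ r : ℝ, 0 < r ∧ ∀ x ∈ ball x₀ r, ∀ u ∈ ball x₀ r, ∀ y ∈ ball x₀ r, ∀ v ∈ ball x₀ r,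
      ∀ ε μ, s.ν ε ≤ 1 → s.ν μ ≤ 1 →
        S.diff ε x u (S.δ μ y v) = S.δ μ (S.diff ε x u y) (S.diff ε x u v) := by
  obtain ⟨r₁, hr₁, h₁⟩ := hL.exists_dil_dil x₀
  obtain ⟨r₂, hr₂, h₂⟩ := S.exists_dil_mem_ball x₀ (show (0 : ℝ) < 1 / 2 by norm_num)
  obtain ⟨r₃, hr₃, h₃⟩ := S.exists_diff_spec x₀ (lt_min hr₁ hr₂)
  obtain ⟨r₄, hr₄, h₄⟩ := S.exists_dil_mem_ball x₀
    (show (0 : ℝ) < min r₁ (1 / 2) by positivity)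
  refine ⟨min r₁ (min r₃ r₄), by positivity, fun x hx u hu y hy v hv ε μ hε hμ => ?_⟩
  simp only [mem_ball, lt_min_iff] at hx hu hy hv h₃ h₄
  obtain ⟨-, hy1, hy2⟩ := h₃ x hx.2.1 u hu.2.1 y hy.2.1 ε hε
  obtain ⟨-, hv1, hv2⟩ := h₃ x hx.2.1 u hu.2.1 v hv.2.1 ε hε
  have hx' := h₄ x hx.2.2 u hu.2.2 ε hε
  have h5 := h₁ _ hx'.1 _ hy1.1 _ hv1.1 ε μ hε hμ
  rw [hy2, hv2, ← h₁ x hx.1 y hy.1 v hv.1 ε μ hε hμ] at h5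
  have h6 := S.inv_apply ε (S.δ ε x u) hε _ (S.ball_subset_U _
    (S.mem_ball_A hx'.2 (h₂ _ hy1.2 _ hv1.2 μ hμ)))
  rwa [h5] at h6

variable {S} in
/-- In a linear structure, the maps `Δ^x_ε(u, ·)` are linear near every point. -/
theorem IsLinear.exists_isLinearOn_diff (hL : S.IsLinear) (x₀ : X) :
    ∃ r : ℝ, 0 < r ∧ ∀ x ∈ ball x₀ r, ∀ u ∈ ball x₀ r, ∀ ε, s.ν ε ≤ 1 →
      (∀ y ∈ ball x₀ r, ∀ v ∈ ball x₀ r, v ∈ S.U y ∧ S.DiffDefined ε x u v ∧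
        S.diff ε x u v ∈ S.U (S.diff ε x u y) ∧
          ∀ μ, s.ν μ ≤ 1 → S.DiffDefined ε x u (S.δ μ y v)) ∧
      S.IsLinearOn (ball x₀ r) (S.diff ε x u) := by
  obtain ⟨ρ, hρ, hlip⟩ := S.exists_lipschitzOnWith x₀
  obtain ⟨r₁, hr₁, h₁⟩ := hL.exists_diff_dil x₀
  obtain ⟨r₂, hr₂, h₂⟩ := S.exists_diff_spec x₀ (show (0 : ℝ) < min ρ (1 / 2) by positivity)
  obtain ⟨r₃, hr₃, h₃⟩ := S.exists_dil_mem_ball x₀ hr₂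
  obtain ⟨r₄, hr₄, L, hL4⟩ := hlip (min r₁ r₂) (lt_min hr₁ hr₂)
  refine ⟨min (min r₁ r₂) (min (min r₃ r₄) (1 / 2)), by positivity,
    fun x hx u hu ε hε => ⟨fun y hy v hv => ?_, ⟨L, ?_⟩, ?_⟩⟩
  · simp only [mem_ball, lt_min_iff] at hx hu hy hv h₂
    refine ⟨S.ball_subset_U y (S.mem_ball_A hy.2.2 hv.2.2),
      (h₂ x hx.1.2 u hu.1.2 v hv.1.2 ε hε).1, S.ball_subset_U _
      (S.mem_ball_A (h₂ x hx.1.2 u hu.1.2 y hy.1.2 ε hε).2.1.2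
        (h₂ x hx.1.2 u hu.1.2 v hv.1.2 ε hε).2.1.2), fun μ hμ => ?_⟩
    exact (h₂ x hx.1.2 u hu.1.2 _ (h₃ y hy.2.1.1 v hv.2.1.1 μ hμ) ε hε).1
  · simp only [mem_ball, lt_min_iff] at hx hu
    refine (hL4 (S.diff ε x u) (fun y hy => ?_) fun y hy v hv μ hμ => ?_).mono
      (ball_subset_ball ((min_le_right _ _).trans ((min_le_left _ _).trans (min_le_right _ _))))
    · exact ball_subset_ball (min_le_left _ _) (h₂ x hx.1.2 u hu.1.2 y
        (ball_subset_ball (min_le_right _ _) hy) ε hε).2.1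
    · exact h₁ x hx.1.1 u hu.1.1 y (ball_subset_ball (min_le_left _ _) hy) v
        (ball_subset_ball (min_le_left _ _) hv) ε μ hε hμ
  · intro y hy v hv _ μ hμ _
    simp only [mem_ball, lt_min_iff] at hx hu hy hv
    exact h₁ x hx.1.1 u hu.1.1 y hy.1.1 v hv.1.1 ε μ hε hμ

variable {S} in
theorem IsLinear.isLinearOn_diff (hL : S.IsLinear) {K : Set X} (hK : IsCompact K) :
    ∃ C : ℝ, 0 < C ∧
      ∀ x ∈ K, ∀ u ∈ ball x C, ∀ ε, s.ν ε ≤ 1 →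
        (∀ y ∈ ball x C, ∀ v ∈ ball x C, v ∈ S.U y ∧ S.DiffDefined ε x u v ∧
          S.diff ε x u v ∈ S.U (S.diff ε x u y) ∧
          ∀ μ, s.ν μ ≤ 1 → S.DiffDefined ε x u (S.δ μ y v)) ∧
        S.IsLinearOn (ball x C) (S.diff ε x u) := by
  choose r hr h using hL.exists_isLinearOn_diff
  obtain ⟨C, hC, hCr⟩ := lebesgue_number_lemma_of_metric hK
    (fun p => isOpen_ball (x := p) (ε := r p)) fun p _ => mem_iUnion.2 ⟨p, mem_ball_self (hr p)⟩
  refine ⟨C, hC, fun x hx u hu ε hε => ?_⟩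
  obtain ⟨p, hp⟩ := hCr x hx
  obtain ⟨h1, h2⟩ := h p x (hp (mem_ball_self hC)) u (hp hu) ε hε
  exact ⟨fun y hy v hv => h1 y (hp hy) v (hp hv), h2.mono hp⟩

end DilatationStructure

/-! ### Local groups presented by their left division -/

/-- `D` is, on `ball e r`, the left division `(u, v) ↦ u⁻¹ v` of a topological local group with
neutral element `e`. The operation of the group is `(u, v) ↦ D (D u e) v` and its inverse is
`u ↦ D u e`. -/
structure IsLocalDivision {X : Type*} [MetricSpace X] (D : X → X → X) (e : X) (r : ℝ) : Prop where
  continuousAt : ∀ u ∈ ball e r, ∀ v ∈ ball e r, ContinuousAt (fun q : X × X => D q.1 q.2) (u, v)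
  base_left : ∀ u ∈ ball e r, D e u = u
  self : ∀ u ∈ ball e r, D u u = e
  div_div : ∀ u ∈ ball e r, ∀ v ∈ ball e r, ∀ w ∈ ball e r, D (D u v) (D u w) = D v w

namespace IsLocalDivision

variable {X : Type*} [MetricSpace X] {D : X → X → X} {e : X} {r : ℝ}

theorem mono (h : IsLocalDivision D e r) {r' : ℝ} (hr : r' ≤ r) : IsLocalDivision D e r' where
  continuousAt u hu v hv := h.continuousAt u (ball_subset_ball hr hu) v (ball_subset_ball hr hv)
  base_left u hu := h.base_left u (ball_subset_ball hr hu)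
  self u hu := h.self u (ball_subset_ball hr hu)
  div_div u hu v hv w hw := h.div_div u (ball_subset_ball hr hu) v (ball_subset_ball hr hv) w
    (ball_subset_ball hr hw)

theorem exists_mem_ball (h : IsLocalDivision D e r) (hr : 0 < r) {ρ : ℝ} (hρ : 0 < ρ) :
    ∃ r' : ℝ, 0 < r' ∧ ∀ u ∈ ball e r', ∀ v ∈ ball e r', D u v ∈ ball e ρ := by
  have he := mem_ball_self (x := e) hr
  have h1 := h.continuousAt e he e he
  have h2 : ∀ᶠ q : X × X in 𝓝 (e, e), D q.1 q.2 ∈ ball e ρ :=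
    h1.eventually_mem (by simpa [h.self e he] using ball_mem_nhds e hρ)
  obtain ⟨r', hr', h3⟩ := Metric.eventually_nhds_iff_ball.1 h2
  refine ⟨r', hr', fun u hu v hv => h3 (u, v) ?_⟩
  rw [← ball_prod_same]
  exact ⟨hu, hv⟩

theorem pos_of_mem {u : X} (hu : u ∈ ball e r) : e ∈ ball e r :=
  mem_ball_self (dist_nonneg.trans_lt hu)

/-- `u⁻¹⁻¹ (u⁻¹ w) = w`. -/
theorem div_inv_div (h : IsLocalDivision D e r) {u w : X} (hu : u ∈ ball e r) (hw : w ∈ ball e r) :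
    D (D u e) (D u w) = w := by
  rw [h.div_div u hu e (pos_of_mem hu) w hw, h.base_left w hw]

theorem inv_inv (h : IsLocalDivision D e r) {u : X} (hu : u ∈ ball e r) : D (D u e) e = u := by
  have := h.div_inv_div hu hu
  rwa [h.self u hu] at this

/-- `u⁻¹ (u w) = w`. -/
theorem div_mul (h : IsLocalDivision D e r) {u w : X} (hu : u ∈ ball e r) (hu' : D u e ∈ ball e r)
    (hw : w ∈ ball e r) : D u (D (D u e) w) = w := by
  have := h.div_inv_div hu' hw
  rwa [h.inv_inv hu] at this

theorem div_left_cancel (h : IsLocalDivision D e r) {u v w : X} (hu : u ∈ ball e r)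
    (hv : v ∈ ball e r) (hw : w ∈ ball e r) (hvw : D u v = D u w) : v = w := by
  rw [← h.div_inv_div hu hv, hvw, h.div_inv_div hu hw]

/-- The operation is associative: `(u v)⁻¹ = D v u⁻¹`, and `D (D v u⁻¹) w` is computed by writing
`w` as `D v (v w)`. -/
theorem assoc (h : IsLocalDivision D e r) {u v w : X} (hu' : D u e ∈ ball e r)
    (hv : v ∈ ball e r) (hv' : D v e ∈ ball e r) (hw : w ∈ ball e r)
    (hvw : D (D v e) w ∈ ball e r) :
    D (D (D (D u e) v) e) w = D (D u e) (D (D v e) w) := by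
  have h1 := h.div_div _ hu' v hv _ hu'
  rw [h.self _ hu'] at h1
  have h2 := h.div_div v hv _ hu' _ hvw
  rw [h.div_mul hv hv' hw] at h2
  rw [h1, h2]

end IsLocalDivision

namespace DilatationStructure

variable {Γ : Type*} [CommGroup Γ] [TopologicalSpace Γ] {s : Scale Γ}
  {X : Type*} [MetricSpace X] (S : DilatationStructure s X)

/-! ### The tangent spaces of a strong structure -/

theorem inv_eq_diff (ε : Γ) (x u : X) : S.inv ε x u = S.diff ε x u x := by
  rw [inv, diff, S.apply_self]

theorem invLim_eq_diffLim (x u : X) : S.invLim x u = S.diffLim x u x := by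
  simp only [invLim, diffLim, inv_eq_diff]

theorem diff_self (ε : Γ) (x u : X) : S.diff ε x u u = S.δ ε x u := S.apply_self _ _

/-- The limit `Δ^e` of the differences is, on `ball e r`, the left division of a local group on
which the dilatations `δ^e` act by morphisms and which carries the left invariant
distance `d^e`. -/
structure IsDifferenceOn (e : X) (r : ℝ) : Prop where
  pos : 0 < r
  le : r ≤ 1 / 2
  div : IsLocalDivision (S.diffLim e) e r
  tendsto_diff : ∀ u ∈ ball e r, ∀ v ∈ ball e r,
    Tendsto (fun ε => S.diff ε e u v) s.toZero (𝓝 (S.diffLim e u v))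
  tendsto_sum : ∀ u ∈ ball e r, ∀ v ∈ ball e r, Tendsto (fun ε => S.sum ε e u v) s.toZero
    (𝓝 (S.diffLim e (S.diffLim e u e) v))
  dil_diff : ∀ u ∈ ball e r, ∀ v ∈ ball e r, ∀ ε, s.ν ε ≤ 1 →
    S.δ ε e (S.diffLim e u v) = S.diffLim e (S.δ ε e u) (S.δ ε e v)
  tnorm_diff : ∀ u ∈ ball e r, ∀ v ∈ ball e r, S.tnorm e (S.diffLim e u v) = S.tdist e u v

variable {S} in
theorem IsDifferenceOn.mono {e : X} {r : ℝ} (h : S.IsDifferenceOn e r) {r' : ℝ} (hr' : 0 < r')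
    (hr : r' ≤ r) : S.IsDifferenceOn e r' where
  pos := hr'
  le := hr.trans h.le
  div := h.div.mono hr
  tendsto_diff u hu v hv := h.tendsto_diff u (ball_subset_ball hr hu) v (ball_subset_ball hr hv)
  tendsto_sum u hu v hv := h.tendsto_sum u (ball_subset_ball hr hu) v (ball_subset_ball hr hv)
  dil_diff u hu v hv := h.dil_diff u (ball_subset_ball hr hu) v (ball_subset_ball hr hv)
  tnorm_diff u hu v hv := h.tnorm_diff u (ball_subset_ball hr hu) v (ball_subset_ball hr hv)

variable {S} in
theorem IsDifferenceOn.sumLim_eq {e : X} {r : ℝ} (h : S.IsDifferenceOn e r) {u v : X}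
    (hu : u ∈ ball e r) (hv : v ∈ ball e r) :
    S.sumLim e u v = S.diffLim e (S.diffLim e u e) v := by
  have : Nonempty X := ⟨e⟩
  exact (h.tendsto_sum u hu v hv).limUnder_eq

variable [LocallyCompactSpace X]

theorem continuousOn_diff (x₀ : X) : ∃ r : ℝ, 0 < r ∧ ∀ ε, s.ν ε ≤ 1 →
    ContinuousOn (fun q : X × X × X => S.diff ε q.1 q.2.1 q.2.2)
      (ball x₀ r ×ˢ ball x₀ r ×ˢ ball x₀ r) := by
  obtain ⟨r, hr, h⟩ := S.exists_diff_spec x₀ one_pos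
  refine ⟨min r (1 / 2), by positivity, fun ε hε => ?_⟩
  refine S.continuousOn.comp
    (f := fun q : X × X × X => (ε⁻¹, S.δ ε q.1 q.2.1, S.δ ε q.1 q.2.2)) ?_ ?_
  · intro q hq
    simp only [mem_prod, mem_ball, lt_min_iff] at hq
    refine ContinuousAt.continuousWithinAt (continuousAt_const.prodMk (ContinuousAt.prodMk ?_ ?_))
    · exact ContinuousAt.comp (f := fun q : X × X × X => (q.1, q.2.1))
        (S.continuousAt_dil hε (S.mem_ball_A hq.1.2 hq.2.1.2)) (by fun_prop)
    · exact ContinuousAt.comp (f := fun q : X × X × X => (q.1, q.2.2))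
        (S.continuousAt_dil hε (S.mem_ball_A hq.1.2 hq.2.2.2)) (by fun_prop)
  · intro q hq
    simp only [mem_prod, mem_ball, lt_min_iff] at hq
    exact (h q.1 hq.1.1 q.2.1 hq.2.1.1 q.2.2 hq.2.2.1 ε hε).1.2.2

variable {S} in
/-- Near every point the limit `Δ^x(u, v)` is continuous in `(x, u, v)`, and the differences
converge to it in the sense of continuous convergence. -/
theorem IsStrong.exists_tendsto_prod_diff (hS : S.IsStrong) (x₀ : X) :
    ∃ r : ℝ, 0 < r ∧ ∀ x ∈ ball x₀ r, ∀ u ∈ ball x₀ r, ∀ v ∈ ball x₀ r,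
      ContinuousAt (fun q : X × X × X => S.diffLim q.1 q.2.1 q.2.2) (x, u, v) ∧
      Tendsto (fun p : Γ × X × X × X => S.diff p.1 p.2.1 p.2.2.1 p.2.2.2)
        (s.toZero ×ˢ 𝓝 (x, u, v)) (𝓝 (S.diffLim x u v)) := by
  obtain ⟨K, hK, hxK⟩ := exists_compact_mem_nhds x₀
  obtain ⟨r, hr, hrK⟩ := Metric.mem_nhds_iff.1 hxK
  obtain ⟨R, hR, h⟩ := hS K hK
  obtain ⟨r₁, hr₁, h₁⟩ := S.continuousOn_diff x₀
  set r' := min (min r r₁) (R / 2) with hr'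
  refine ⟨r', by positivity, fun x hx u hu v hv => ?_⟩
  set G : Set (X × X × X) := ball x₀ r' ×ˢ ball x₀ r' ×ˢ ball x₀ r' with hG
  have hGopen : IsOpen G := isOpen_ball.prod (isOpen_ball.prod isOpen_ball)
  have hunif := h.mono (s' := G) fun q hq => by
    simp only [hG, mem_prod, mem_ball, hr', lt_min_iff] at hq
    refine ⟨hrK hq.1.1.1, ?_, ?_⟩ <;> rw [mem_closedBall]
    · linarith [dist_triangle_right q.2.1 q.1 x₀]
    · linarith [dist_triangle_right q.2.2 q.1 x₀]
  refine tendsto_prod_of_tendstoUniformlyOn (y := (x, u, v)) hunif ?_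
    (hGopen.mem_nhds ⟨hx, hu, hv⟩)
  filter_upwards [s.eventually_lt one_pos] with ε hε
  have hle : ball x₀ r' ⊆ ball x₀ r₁ :=
    ball_subset_ball ((min_le_left _ _).trans (min_le_right _ _))
  exact (h₁ ε hε.le).mono (prod_mono hle (prod_mono hle hle))

variable {S} in
/-- The identities between differences of coefficient `ε` pass to the limit `ε → 0`. -/
theorem IsStrong.exists_isDifferenceOn (hS : S.IsStrong) (e : X) :
    ∃ r : ℝ, S.IsDifferenceOn e r := by
  obtain ⟨r₁, hr₁, h₁⟩ := hS.exists_tendsto_prod_diff e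
  obtain ⟨r₂, hr₂, h₂⟩ := S.exists_diff_spec e (show 0 < min (r₁ / 2) (1 / 4) by positivity)
  obtain ⟨r₃, hr₃, h₃⟩ := S.exists_dil_mem_ball e (show 0 < min r₁ (1 / 2) by positivity)
  set r : ℝ := min (min r₁ r₂) (min r₃ (1 / 2)) with hr
  have hr0 : 0 < r := by positivity
  have hle₁ : ball e r ⊆ ball e r₁ := ball_subset_ball ((min_le_left _ _).trans (min_le_left _ _))
  have hle₂ : ball e r ⊆ ball e r₂ := ball_subset_ball ((min_le_left _ _).trans (min_le_right _ _))
  have hle₃ : ball e r ⊆ ball e r₃ := ball_subset_ball ((min_le_right _ _).trans (min_le_left _ _))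
  have hle : r ≤ 1 / 2 := (min_le_right _ _).trans (min_le_right _ _)
  have he := mem_ball_self (x := e) hr0
  have hdiff : ∀ u ∈ ball e r₁, ∀ v ∈ ball e r₁,
      Tendsto (fun ε => S.diff ε e u v) s.toZero (𝓝 (S.diffLim e u v)) := fun u hu v hv =>
    (h₁ e (hle₁ he) u hu v hv).2.comp (tendsto_id.prodMk tendsto_const_nhds)
  have hdil : ∀ u ∈ ball e r, Tendsto (fun ε => S.δ ε e u) s.toZero (𝓝 e) := fun u hu =>
    S.tendsto_zero e u (S.ball_subset_U e
      (S.mem_ball_A (ball_subset_ball hle he) (ball_subset_ball hle hu)))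
  have hmem : ∀ u ∈ ball e r, ∀ v ∈ ball e r,
      S.diffLim e u v ∈ ball e r₁ ∧ S.diffLim e u v ∈ ball e (1 / 2) := by
    intro u hu v hv
    have h4 : S.diffLim e u v ∈ closedBall e (min (r₁ / 2) (1 / 4)) := by
      refine isClosed_closedBall.mem_of_tendsto (hdiff u (hle₁ hu) v (hle₁ hv)) ?_
      filter_upwards [s.eventually_lt one_pos] with ε hε
      exact ball_subset_closedBall (h₂ e (hle₂ he) u (hle₂ hu) v (hle₂ hv) ε hε.le).2.1
    rw [mem_closedBall, le_min_iff] at h4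
    constructor <;> rw [mem_ball] <;> linarith [h4.1, h4.2]
  refine ⟨r, hr0, hle, ⟨?_, ?_, ?_, ?_⟩, ?_, ?_, ?_, ?_⟩
  · intro u hu v hv
    exact ContinuousAt.comp (f := fun q : X × X => (e, q.1, q.2)) (x := (u, v))
      (h₁ e (hle₁ he) u (hle₁ hu) v (hle₁ hv)).1 (by fun_prop)
  · intro u hu
    refine tendsto_nhds_unique_of_eventuallyEq (hdiff e (hle₁ he) u (hle₁ hu)) tendsto_const_nhds ?_
    filter_upwards [s.eventually_lt one_pos] with ε hε
    rw [diff, S.apply_self, S.inv_apply ε e hε.le u (S.ball_subset_U e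
      (S.mem_ball_A (ball_subset_ball hle he) (ball_subset_ball hle hu)))]
  · intro u hu
    exact tendsto_nhds_unique (hdiff u (hle₁ hu) u (hle₁ hu))
      (by simpa only [S.diff_self] using hdil u hu)
  · intro u hu v hv w hw
    have h4 := (h₁ e (hle₁ he) _ (hmem u hu v hv).1 _ (hmem u hu w hw).1).2.comp
      (tendsto_id.prodMk ((hdil u hu).prodMk_nhds ((hdiff u (hle₁ hu) v (hle₁ hv)).prodMk_nhds
        (hdiff u (hle₁ hu) w (hle₁ hw)))))
    refine tendsto_nhds_unique_of_eventuallyEq h4 (hdiff v (hle₁ hv) w (hle₁ hw)) ?_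
    filter_upwards [s.eventually_lt one_pos] with ε hε
    simp only [Function.comp_apply, id]
    rw [diff, (h₂ e (hle₂ he) u (hle₂ hu) v (hle₂ hv) ε hε.le).2.2,
      (h₂ e (hle₂ he) u (hle₂ hu) w (hle₂ hw) ε hε.le).2.2, ← diff]
  · exact fun u hu v hv => hdiff u (hle₁ hu) v (hle₁ hv)
  · intro u hu v hv
    have h4 := (h₁ e (hle₁ he) _ (hmem u hu e he).1 v (hle₁ hv)).2.comp
      (tendsto_id.prodMk ((hdil u hu).prodMk_nhds ((hdiff u (hle₁ hu) e (hle₁ he)).prodMk_nhds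
        (tendsto_const_nhds (x := v)))))
    refine h4.congr' ?_
    filter_upwards [s.eventually_lt one_pos] with ε hε
    simp only [Function.comp_apply, id]
    rw [diff, (h₂ e (hle₂ he) u (hle₂ hu) e (hle₂ he) ε hε.le).2.2, S.apply_self, sum]
  · intro u hu v hv ε hε
    have h4 := h₃ e (hle₃ he) u (hle₃ hu) ε hε
    have h5 := h₃ e (hle₃ he) v (hle₃ hv) ε hε
    rw [mem_ball, lt_min_iff] at h4 h5
    have h6 := (s.tendsto_mul_right ε)
    have h7 := (S.continuousAt_dil hε (S.mem_ball_A (ball_subset_ball hle he)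
      (hmem u hu v hv).2)).tendsto.comp (((hdil u hu).comp h6).prodMk_nhds
        ((hdiff u (hle₁ hu) v (hle₁ hv)).comp h6))
    refine tendsto_nhds_unique_of_eventuallyEq h7 (hdiff _ h4.1 _ h5.1) ?_
    filter_upwards [s.eventually_lt one_pos] with μ hμ
    have hμε := s.map_mul_le_one hμ.le hε
    have hA : ∀ w ∈ ball e r, w ∈ closedBall e S.A := fun w hw =>
      S.mem_closedBall_A (ball_subset_ball hle he) (ball_subset_ball hle hw)
    obtain ⟨-, h8, h9⟩ := h₂ e (hle₂ he) u (hle₂ hu) v (hle₂ hv) (μ * ε) hμε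
    have h10 := h₃ e (hle₃ he) u (hle₃ hu) (μ * ε) hμε
    rw [mem_ball, lt_min_iff] at h8 h10
    have h11 : S.diff (μ * ε) e u v ∈ closedBall (S.δ (μ * ε) e u) S.A :=
      S.mem_closedBall_A h10.2 (by rw [mem_ball]; linarith [h8.2])
    change _ = S.δ μ⁻¹ (S.δ μ e (S.δ ε e u)) (S.δ μ e (S.δ ε e v))
    simp only [Function.comp_apply]
    rw [S.mul_apply μ ε e hμ.le hε u (hA u hu), S.mul_apply μ ε e hμ.le hε v (hA v hv),
      ← h9, ← S.mul_apply μ ε _ hμ.le hε _ h11, S.inv_apply μ _ hμ.le _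
      (S.dil_mem_U hε (S.closedBall_subset_U _ h11))]
  · intro u hu v hv
    have h4 := (S.tendsto_prod_tdist (mem_ball_self (x := e) S.A_pos) (S.mem_ball_A
      (ball_subset_ball hle he) (hmem u hu v hv).2)).2.comp (tendsto_id.prodMk
        ((hdil u hu).prodMk_nhds ((hdil u hu).prodMk_nhds (hdiff u (hle₁ hu) v (hle₁ hv)))))
    refine tendsto_nhds_unique_of_eventuallyEq h4 (S.tendsto_tdist
      (S.mem_closedBall_A (ball_subset_ball hle he) (ball_subset_ball hle hu))
      (S.mem_closedBall_A (ball_subset_ball hle he) (ball_subset_ball hle hv))) ?_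
    filter_upwards [s.eventually_lt one_pos] with ε hε
    simp only [Function.comp_apply, id]
    rw [S.apply_self, (h₂ e (hle₂ he) u (hle₂ hu) v (hle₂ hv) ε hε.le).2.2]

end DilatationStructure

namespace DilatationStructure

variable {Γ : Type*} [CommGroup Γ] [TopologicalSpace Γ] {s : Scale Γ}
  {X : Type*} [MetricSpace X] (S : DilatationStructure s X)

/-- The dilatations based at `x` are a local action of the whole group `Γ`: near `x` every point is
of the form `δ^x_γ w` with `ν(γ)` as small as needed. -/
theorem eventually_dil_dil (ε μ : Γ) (x : X) :
    ∀ᶠ u in 𝓝 x, S.δ ε x (S.δ μ x u) = S.δ (ε * μ) x u := by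
  have h1 := s.tendsto_mul_right μ
  have h2 := s.tendsto_mul_right (ε * μ)
  obtain ⟨γ, hγ, hγμ, hγε⟩ := ((s.eventually_lt one_pos).and
    ((h1.eventually (s.eventually_lt one_pos)).and
      (h2.eventually (s.eventually_lt one_pos)))).exists
  rw [mul_comm] at hγμ hγε
  filter_upwards [ball_mem_nhds x (s.pos γ)] with u hu
  obtain ⟨w, hw, rfl⟩ := S.ball_subset_image γ x hγ hu
  have hw := ball_subset_closedBall hw
  rw [S.dil_dil hγ.le hγμ.le hw, S.dil_dil hγ.le hγε.le hw, mul_assoc,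
    S.dil_dil hγμ.le (by rw [← mul_assoc]; exact hγε.le) hw]

variable {S}

theorem IsDifferenceOn.mem_closedBall_A {e : X} {r : ℝ} (h : S.IsDifferenceOn e r) {u v : X}
    (hu : u ∈ ball e r) (hv : v ∈ ball e r) : v ∈ closedBall u S.A :=
  S.mem_closedBall_A (ball_subset_ball h.le hu) (ball_subset_ball h.le hv)

theorem IsDifferenceOn.mem_ball_A {e : X} {r : ℝ} (h : S.IsDifferenceOn e r) {u v : X}
    (hu : u ∈ ball e r) (hv : v ∈ ball e r) : v ∈ ball u S.A :=
  S.mem_ball_A (ball_subset_ball h.le hu) (ball_subset_ball h.le hv)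

variable [LocallyCompactSpace X]

theorem IsDifferenceOn.exists_isTangentGroupOn {e : X} {r : ℝ} (h : S.IsDifferenceOn e r) :
    ∃ r₀ : ℝ, 0 < r₀ ∧ ∀ r', 0 < r' → r' ≤ r₀ → S.IsTangentGroupOn e (ball e r') := by
  obtain ⟨r₁, hr₁, h₁⟩ := h.div.exists_mem_ball h.pos h.pos
  obtain ⟨r₂, hr₂, h₂⟩ := h.div.exists_mem_ball h.pos (show 0 < min r r₁ from lt_min h.pos hr₁)
  obtain ⟨r₃, hr₃, h₃⟩ := S.exists_dil_mem_ball e h.pos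
  obtain ⟨K, hK, heK⟩ := exists_compact_mem_nhds e
  obtain ⟨r₄, hr₄, h₄⟩ := Metric.mem_nhds_iff.1 heK
  have hr := h.pos
  refine ⟨min (min (r₁ / 2) r₂) (min r₃ (min (r / 2) (r₄ / 2))), by positivity, fun r' hr' hle => ?_⟩
  simp only [le_min_iff] at hle
  have he : e ∈ ball e r' := mem_ball_self hr'
  have hO : ball e r' ⊆ ball e r := ball_subset_ball (by linarith [hle.2.2.1])
  have hO₁ : ball e r' ⊆ ball e r₁ := ball_subset_ball (by linarith [hle.1.1])
  have hO₂ : ball e r' ⊆ ball e r₂ := ball_subset_ball hle.1.2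
  have hO₃ : ball e r' ⊆ ball e r₃ := ball_subset_ball hle.2.1
  have hcl : closedBall e r' ⊆ ball e r := closedBall_subset_ball (by linarith [hle.2.2.1])
  have hcl₁ : closedBall e r' ⊆ ball e r₁ := closedBall_subset_ball (by linarith [hle.1.1])
  have hcompact : IsCompact (closedBall e r') := hK.of_isClosed_subset isClosed_closedBall
    ((closedBall_subset_ball (by linarith [hle.2.2])).trans h₄)
  have hinv : ∀ u ∈ ball e r', S.diffLim e u e ∈ ball e r ∧ S.diffLim e u e ∈ ball e r₁ := by
    intro u hu
    have := h₂ u (hO₂ hu) e (hO₂ he)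
    rwa [mem_ball, lt_min_iff] at this
  have hmul : ∀ u ∈ ball e r', ∀ v ∈ ball e r', S.diffLim e (S.diffLim e u e) v ∈ ball e r :=
    fun u hu v hv => h₁ _ (hinv u hu).2 v (hO₁ hv)
  have hdil : ∀ ε, s.ν ε ≤ 1 → ∀ u ∈ ball e r', S.δ ε e u ∈ ball e r := fun ε hε u hu =>
    h₃ e (hO₃ he) u (hO₃ hu) ε hε
  have hsum : ∀ u ∈ ball e r, ∀ v ∈ ball e r,
      S.sumLim e u v = S.diffLim e (S.diffLim e u e) v := fun u hu v hv => h.sumLim_eq hu hv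
  have hU : ball e r' ⊆ S.U e := fun u hu => S.ball_subset_U e (h.mem_ball_A (hO he) (hO hu))
  have hA : ∀ u ∈ ball e r, u ∈ closedBall e S.A := fun u hu => h.mem_closedBall_A (hO he) hu
  have hinv_cont : ContinuousOn (fun u => S.diffLim e u e) (ball e r) := fun u hu =>
    (ContinuousAt.comp (f := fun u => (u, e)) (h.div.continuousAt u hu e (hO he))
      (by fun_prop)).continuousWithinAt
  refine ⟨hU, fun u hu v hv => h.tendsto_diff u (hO hu) v (hO hv), fun u hu v hv => ?_,
    fun u hu => ?_, ?_, fun u hu v hv => ?_⟩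
  · rw [hsum u (hO hu) v (hO hv)]
    exact h.tendsto_sum u (hO hu) v (hO hv)
  · simp only [inv_eq_diff, invLim_eq_diffLim]
    exact h.tendsto_diff u (hO hu) e (hO he)
  · refine
      { isOpen := isOpen_ball
        mem := he
        one_mul := fun u hu => ?_
        mul_one := fun u hu => ?_
        mul_inv := fun u hu => ?_
        inv_mul := fun u hu => ?_
        assoc := fun u hu v hv w hw => ?_
        mul_unif := ?_
        inv_unif := ?_
        dil_one := fun u hu => S.one_apply e u (hU hu)
        dil_mul := fun ε μ => S.eventually_dil_dil ε μ e
        dil_cont := ?_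
        dil_morphism := fun ε hε u hu v hv => ?_
        dil_tendsto := fun u hu => S.tendsto_zero e u (hU hu)
        nrm_cont := fun u hu => ?_
        nrm_nonneg := fun u hu => S.tdist_nonneg (hA e (hO he)) (hA u (hO hu))
        nrm_eq_zero := fun u hu h0 =>
          (S.nondegenerate e e (hA e (hO he)) u (hA u (hO hu)) h0).symm
        nrm_mul := fun u hu v hv => ?_
        nrm_inv := fun u hu => ?_
        nrm_dil := fun ε hε u hu =>
          S.tdist_base_dil hε (hA u (hO hu)) (hA _ (hdil ε hε u hu)) }
    · rw [hsum e (hO he) u (hO hu), h.div.self e (hO he), h.div.base_left u (hO hu)]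
    · rw [hsum u (hO hu) e (hO he), h.div.inv_inv (hO hu)]
    · rw [invLim_eq_diffLim, hsum u (hO hu) _ (hinv u hu).1, h.div.self _ (hinv u hu).1]
    · rw [invLim_eq_diffLim, hsum _ (hinv u hu).1 u (hO hu), h.div.inv_inv (hO hu),
        h.div.self u (hO hu)]
    · rw [hsum u (hO hu) v (hO hv), hsum _ (hmul u hu v hv) w (hO hw), hsum v (hO hv) w (hO hw),
        hsum u (hO hu) _ (hmul v hv w hw)]
      exact h.div.assoc (hinv u hu).1 (hO hv) (hinv v hv).1 (hO hw) (hmul v hv w hw)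
    · have hc : ContinuousOn (fun p : X × X => S.diffLim e (S.diffLim e p.1 e) p.2)
          (closedBall e r' ×ˢ closedBall e r') := fun p hp =>
        ContinuousAt.comp_continuousWithinAt (f := fun p : X × X => (S.diffLim e p.1 e, p.2))
          (h.div.continuousAt _ (h₁ _ (hcl₁ hp.1) e (hO₁ he)) p.2 (hcl hp.2))
          (((hinv_cont p.1 (hcl hp.1)).mono hcl |>.comp continuousWithinAt_fst fun q hq =>
            hq.1).prodMk continuousWithinAt_snd)
      refine (((hcompact.prod hcompact).uniformContinuousOn_of_continuous hc).mono (prod_mono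
        ball_subset_closedBall ball_subset_closedBall)).congr fun p hp => ?_
      exact (hsum p.1 (hO hp.1) p.2 (hO hp.2)).symm
    · simp only [funext (S.invLim_eq_diffLim e)]
      exact (hcompact.uniformContinuousOn_of_continuous (hinv_cont.mono hcl)).mono
        ball_subset_closedBall
    · refine S.continuousOn.comp (f := fun p : Γ × X => (p.1, e, p.2)) (by fun_prop) fun p hp =>
        ⟨fun _ => hU hp.2, fun h' => absurd h' (not_lt.2 hp.1)⟩
    · rw [hsum u (hO hu) v (hO hv), hsum _ (hdil ε hε u hu) _ (hdil ε hε v hv),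
        h.dil_diff _ (hinv u hu).1 v (hO hv) ε hε, h.dil_diff u (hO hu) e (hO he) ε hε,
        S.apply_self]
    · exact (ContinuousAt.comp (f := fun u => (e, e, u)) (x := u)
        (S.tendsto_prod_tdist (h.mem_ball_A (hO he) (hO he))
          (h.mem_ball_A (hO he) (hO hu))).1 (by fun_prop)).continuousWithinAt
    · rw [hsum u (hO hu) v (hO hv), h.tnorm_diff _ (hinv u hu).1 v (hO hv)]
      refine (S.tdist_triangle (hA _ (hinv u hu).1) (hA e (hO he)) (hA v (hO hv))).trans ?_
      rw [S.tdist_comm, ← tnorm, h.tnorm_diff u (hO hu) e (hO he), S.tdist_comm]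
      rfl
    · rw [invLim_eq_diffLim, h.tnorm_diff u (hO hu) e (hO he), S.tdist_comm]
      rfl
  · rw [invLim_eq_diffLim, hsum _ (hinv u hu).1 v (hO hv), h.div.inv_inv (hO hu)]

/-! ### Linearity and the tangent groups -/

/-- In a strong linear structure, `Δ^e(u, ·)` intertwines the dilatations based at `u` and at the
neutral element `e = Δ^e(u, u)`. -/
theorem IsLinear.exists_diffLim_dil (hL : S.IsLinear) {e : X} {r : ℝ} (h : S.IsDifferenceOn e r) :
    ∃ r' : ℝ, 0 < r' ∧ ∀ u ∈ ball e r', ∀ v ∈ ball e r', ∀ μ, s.ν μ ≤ 1 →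
      S.diffLim e u (S.δ μ u v) = S.δ μ e (S.diffLim e u v) := by
  obtain ⟨r₁, hr₁, h₁⟩ := hL.exists_diff_dil e
  obtain ⟨r₂, hr₂, h₂⟩ := S.exists_dil_mem_ball e h.pos
  obtain ⟨r₃, hr₃, h₃⟩ := h.div.exists_mem_ball h.pos h.pos
  have hr := h.pos
  refine ⟨min (min r₁ r₂) (min r₃ r), by positivity, fun u hu v hv μ hμ => ?_⟩
  simp only [mem_ball, lt_min_iff] at hu hv
  have he := mem_ball_self (x := e) h.pos
  have h4 := h.tendsto_diff u hu.2.2 u hu.2.2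
  rw [h.div.self u hu.2.2] at h4
  have h5 := (S.continuousAt_dil hμ (h.mem_ball_A he (h₃ u hu.2.1 v hv.2.1))).tendsto.comp
    (h4.prodMk_nhds (h.tendsto_diff u hu.2.2 v hv.2.2))
  refine tendsto_nhds_unique_of_eventuallyEq
    (h.tendsto_diff u hu.2.2 _ (h₂ u hu.1.2 v hv.1.2 μ hμ)) h5 ?_
  filter_upwards [s.eventually_lt one_pos] with ε hε
  exact h₁ e (mem_ball_self hr₁) u hu.1.1 u hu.1.1 v hv.1.1 ε μ hε.le hμ

/-- Conversely, if the dilatations near `e` are those of the tangent group at `e`, then they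
commute: `Δ^e(a, ·)`, where `a = δ^x_ε y`, takes the same value `δ^e_{εμ} Δ^e(y, z)` at both
sides. -/
theorem IsDifferenceOn.exists_dil_dil {e : X} {r : ℝ} (h : S.IsDifferenceOn e r)
    (hd : ∀ u ∈ ball e r, ∀ v ∈ ball e r, ∀ μ, s.ν μ ≤ 1 →
      S.diffLim e u (S.δ μ u v) = S.δ μ e (S.diffLim e u v)) :
    ∃ r' : ℝ, 0 < r' ∧ ∀ x ∈ ball e r', ∀ y ∈ ball e r', ∀ z ∈ ball e r',
      ∀ ε μ, s.ν ε ≤ 1 → s.ν μ ≤ 1 →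
        S.δ ε x (S.δ μ y z) = S.δ μ (S.δ ε x y) (S.δ ε x z) := by
  have hr := h.pos
  obtain ⟨r₁, hr₁, h₁⟩ := S.exists_dil_mem_ball e hr
  obtain ⟨r₃, hr₃, h₃⟩ := h.div.exists_mem_ball h.pos h.pos
  obtain ⟨r₂, hr₂, h₂⟩ := S.exists_dil_mem_ball e (show 0 < min (min r r₁) r₃ by positivity)
  refine ⟨min (min r r₁) (min r₂ r₃), by positivity, fun x hx y hy z hz ε μ hε hμ => ?_⟩
  simp only [mem_ball, lt_min_iff] at hx hy hz h₂
  have he := mem_ball_self (x := e) h.pos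
  have ha := h₂ x hx.2.1 y hy.2.1 ε hε
  have hb := h₂ x hx.2.1 z hz.2.1 ε hε
  have hc := h₂ y hy.2.1 z hz.2.1 μ hμ
  have hl := h₁ x hx.1.2 _ hc.1.2 ε hε
  have hab := h₁ _ ha.1.2 _ hb.1.2 μ hμ
  -- `Δ^e(δ^x_ε v, δ^x_ε w) = δ^e_ε Δ^e(v, w)`
  have hkey : ∀ v ∈ ball e r, S.δ ε x v ∈ ball e r → S.diffLim e x v ∈ ball e r →
      ∀ w ∈ ball e r, S.δ ε x w ∈ ball e r → S.diffLim e x w ∈ ball e r →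
      S.diffLim e (S.δ ε x v) (S.δ ε x w) = S.δ ε e (S.diffLim e v w) := by
    intro v hv hv' hxv w hw hw' hxw
    rw [← h.div.div_div x hx.1.1 _ hv' _ hw', hd x hx.1.1 v hv ε hε, hd x hx.1.1 w hw ε hε,
      ← h.dil_diff _ hxv _ hxw ε hε, h.div.div_div x hx.1.1 v hv w hw]
  have hxy := h₃ x hx.2.2 y hy.2.2
  have hyz := h.mem_closedBall_A he (h₃ y hy.2.2 z hz.2.2)
  refine h.div.div_left_cancel ha.1.1 hl hab ?_
  rw [hkey y hy.1.1 ha.1.1 hxy _ hc.1.1 hl (h₃ x hx.2.2 _ hc.2), hd y hy.1.1 z hz.1.1 μ hμ,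
    hd _ ha.1.1 _ hb.1.1 μ hμ,
    hkey y hy.1.1 ha.1.1 hxy z hz.1.1 hb.1.1 (h₃ x hx.2.2 z hz.2.2),
    S.mul_apply ε μ e hε hμ _ hyz, S.mul_apply μ ε e hμ hε _ hyz, mul_comm]

/-- In a strong linear structure, the dilatations near `e` are those of the tangent group at `e`. -/
theorem IsLinear.exists_agreesWithTangentGroup (hL : S.IsLinear) {e : X} {r : ℝ}
    (h : S.IsDifferenceOn e r) : ∃ O D, S.AgreesWithTangentGroup e O D := by
  obtain ⟨r₀, hr₀, hO⟩ := h.exists_isTangentGroupOn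
  obtain ⟨r₁, hr₁, h₁⟩ := hL.exists_diffLim_dil h
  have hr := h.pos
  set R : ℝ := min r r₀ with hR
  have hR0 : 0 < R := by positivity
  obtain ⟨r₂, hr₂, h₂⟩ := S.exists_dil_mem_ball e hR0
  obtain ⟨r₃, hr₃, h₃⟩ := h.div.exists_mem_ball h.pos (show 0 < min R r₂ by positivity)
  set ρ : ℝ := min (min r₁ r₂) (min r₃ R) / 2 with hρ
  have hρ0 : 0 < ρ := by positivity
  have hρlt : ρ < min (min r₁ r₂) (min r₃ R) := half_lt_self (by positivity)
  have hcl : closure (ball e ρ) ⊆ ball e (min (min r₁ r₂) (min r₃ R)) :=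
    closure_ball_subset_closedBall.trans (closedBall_subset_ball hρlt)
  have hmem : ∀ u ∈ closure (ball e ρ),
      (u ∈ ball e r₁ ∧ u ∈ ball e r₂) ∧ u ∈ ball e r₃ ∧ u ∈ ball e R := fun u hu => by
    have := hcl hu
    simpa only [mem_ball, lt_min_iff] using this
  have hRr : ball e R ⊆ ball e r := ball_subset_ball (min_le_left _ _)
  have he : e ∈ closure (ball e ρ) := subset_closure (mem_ball_self hρ0)
  have hdiff : ∀ u ∈ closure (ball e ρ), ∀ v ∈ closure (ball e ρ),
      S.diffLim e u v ∈ ball e R ∧ S.diffLim e u v ∈ ball e r₂ := fun u hu v hv => by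
    have := h₃ u (hmem u hu).2.1 v (hmem v hv).2.1
    simpa only [mem_ball, lt_min_iff] using this
  have hdil : ∀ u ∈ closure (ball e ρ), ∀ v ∈ closure (ball e ρ), ∀ μ, s.ν μ ≤ 1 →
      S.δ μ e (S.diffLim e u v) ∈ ball e R := fun u hu v hv μ hμ =>
    h₂ e (mem_ball_self hr₂) _ (hdiff u hu v hv).2 μ hμ
  have htan := hO R hR0 (min_le_right _ _)
  have hsum : ∀ u ∈ closure (ball e ρ), ∀ v ∈ closure (ball e ρ), ∀ μ, s.ν μ ≤ 1 →
      S.δ μ u v = S.sumLim e u (S.δ μ e (S.diffLim e u v)) := fun u hu v hv μ hμ => by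
    have huR := hRr (hmem u hu).2.2
    rw [h.sumLim_eq huR (hRr (hdil u hu v hv μ hμ)),
      ← h₁ u (hmem u hu).1.1 v (hmem v hv).1.1 μ hμ, h.div.div_inv_div huR
      (hRr (h₂ u (hmem u hu).1.2 v (hmem v hv).1.2 μ hμ))]
  refine ⟨ball e R, ball e ρ, htan, isOpen_ball, mem_ball_self hρ0,
    fun u hu => (hmem u hu).2.2, fun u hu => ?_, fun u hu v hv => (hdiff u hu v hv).1, hdil,
    fun u hu v hv => S.ball_subset_U u
      (h.mem_ball_A (hRr (hmem u hu).2.2) (hRr (hmem v hv).2.2)),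
    fun u hu v hv => ?_, fun u hu v hv μ hμ => ?_, hsum⟩
  · rw [invLim_eq_diffLim]
    exact (hdiff u hu e he).1
  · rw [groupDist, ← htan.diff_eq u (hmem u hu).2.2 v (hmem v hv).2.2,
      h.tnorm_diff u (hRr (hmem u hu).2.2) v (hRr (hmem v hv).2.2)]
  · rw [groupDil, ← htan.diff_eq u (hmem u hu).2.2 v (hmem v hv).2.2]
    exact hsum u hu v hv μ hμ

theorem AgreesWithTangentGroup.exists_dil_dil {e : X} {O D : Set X}
    (hD : S.AgreesWithTangentGroup e O D) {r : ℝ} (h : S.IsDifferenceOn e r) :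
    ∃ r' : ℝ, 0 < r' ∧ ∀ x ∈ ball e r', ∀ y ∈ ball e r', ∀ z ∈ ball e r',
      ∀ ε μ, s.ν ε ≤ 1 → s.ν μ ≤ 1 →
        S.δ ε x (S.δ μ y z) = S.δ μ (S.δ ε x y) (S.δ ε x z) := by
  obtain ⟨r₁, hr₁, h₁⟩ := Metric.isOpen_iff.1 hD.isOpen e hD.mem
  obtain ⟨r₂, hr₂, h₂⟩ := S.exists_dil_mem_ball e h.pos
  obtain ⟨r₃, hr₃, h₃⟩ := h.div.exists_mem_ball h.pos (show 0 < min r r₂ from lt_min h.pos hr₂)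
  have hr := h.pos
  refine (h.mono (r' := min r (min r₁ r₃)) (by positivity) (min_le_left _ _)).exists_dil_dil
    fun u hu v hv μ hμ => ?_
  simp only [mem_ball, lt_min_iff] at hu hv h₃
  have h4 := h₂ e (mem_ball_self hr₂) _ (h₃ u hu.2.2 v hv.2.2).2 μ hμ
  rw [hD.dil_eq_sum_diff u (subset_closure (h₁ hu.2.1)) v (subset_closure (h₁ hv.2.1)) μ hμ,
    h.sumLim_eq hu.1 h4,
    h.div.div_mul hu.1 (h₃ u hu.2.2 e (by rwa [dist_self])).1 h4]

end DilatationStructure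
end Dilatation

theorem theorem5p11 {Γ : Type*} [CommGroup Γ] [TopologicalSpace Γ] [IsTopologicalGroup Γ]
    [T2Space Γ] (s : Dilatation.Scale Γ) {X : Type*} [MetricSpace X] [CompleteSpace X]
    [LocallyCompactSpace X] (S : Dilatation.DilatationStructure s X) :
    (S.IsLinear →
      ∀ K : Set X, IsCompact K → K.Nonempty → ∃ C : ℝ, 0 < C ∧
        ∀ x ∈ K, ∀ u ∈ ball x C, ∀ ε, s.ν ε ≤ 1 →
          (∀ y ∈ ball x C, ∀ v ∈ ball x C, v ∈ S.U y ∧ S.DiffDefined ε x u v ∧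
            S.diff ε x u v ∈ S.U (S.diff ε x u y) ∧
            ∀ μ, s.ν μ ≤ 1 → S.DiffDefined ε x u (S.δ μ y v)) ∧
          S.IsLinearOn (ball x C) (S.diff ε x u)) ∧
    (S.IsStrong →
      (∀ x, ∃ O, S.IsTangentGroupOn x O) ∧
      (S.IsLinear ↔ ∀ x, ∃ O D, S.AgreesWithTangentGroup x O D)) := by
  refine ⟨fun hL K hK _ => hL.isLinearOn_diff hK, fun hS => ⟨fun x => ?_, fun hL x => ?_,
    fun h => S.isLinear_of_locally fun x => ?_⟩⟩ <;>
    obtain ⟨r, hr⟩ := hS.exists_isDifferenceOn x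
  · obtain ⟨r₀, hr₀, hO⟩ := hr.exists_isTangentGroupOn
    exact ⟨_, hO r₀ hr₀ le_rfl⟩
  · exact hL.exists_agreesWithTangentGroup hr
  · obtain ⟨O, D, hD⟩ := h x
    exact hD.exists_dil_dil hr
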